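/- Let $s\ge 2$. Let $k\ge1$, $k+1\le d\le n-1$, $s=d-k+1$, $r=n-k$, $m=\lceil n/(s+1)\rceil$, $\ell=s^{m}$, and let $F$ be a field. Index the symbols of a node by $i\in\{0,\dots,\ell-1\}$, with base-$s$ digits $i=(i_{m-1},\dots,i_0)$, and write the nodes as $C_{a(s+1)+b}\in F^{\ell}$ with group index $0\le a<m$ and in-group index $0\le b\le s$. For scalars $\lambda_{a,b,e}\in F$ ($0\le a<m$, $0\le b\le s$, $0\le e<s$) and $t\ge 0$ put $L^{(t)}_{a,b,e}=(1,\lambda_{a,b,e},\dots,\lambda_{a,b,e}^{t-1})^T$, and let $A^{(t)}_{a,b}$ be the $\ell t\times \ell$ matrix whose $(i,j)$ block is the column $L^{(t)}_{a,b,j_a}$ if $i=j$, the column $-L^{(t)}_{a,b,j_a}$ if $i_a=b\ne j_a$ and $i_u=j_u$ for all $u\neq a$, and $0$ otherwise. Call the scalars admissible if they are pairwise distinct and, for every $a$ and every $\mathcal B=\{b_1<\dots<b_t\}\subseteq\{0,\dots,s\}$, the square matrix $[A^{(t)}_{a,b_1}\ \cdots\ A^{(t)}_{a,b_t}]$ is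 invertible. Let $\mathcal C$ be the array code of all $(C_0,\dots,C_{n-1})\in (F^{\ell})^{n}$ with $\sum_{a(s+1)+b<n} A^{(r)}_{a,b}C_{a(s+1)+b}=0$. An $(N,K,\ell')$ MDS array code is a linear code in $(F^{\ell'})^N$ of dimension $K\ell'$ in which any $K$ of the $N$ nodes determine the codeword. An $(n,k,\ell)$ MSR code with repair degree $d$ is an $(n,k,\ell)$ MDS array code in which every node can be recovered from every set of $d$ other (helper) nodes by downloading from them (linear functions of their contents with) in total exactly $d\ell/(d-k+1)$ symbols, the value of the cut-set bound. (1) Let the scalars be admissible. Then the following holds. (1a) Let $h=a(s+1)+b<n$ with $b<s$. The block rows with index $i$, $i_a=b$, of the parity-check equations of $\mathcal C$ are the parity-check equations, in the vectors $(C_z(i))_{i_a=b}$, $z\ne h$, and $(C_h(i))_{i_a=c}$, $0\le c<s$, of an $(n+s-1,k+s-1,\ell/s)$ MDS array code. Its parity-check matrices are: for $z$ in group $a$ with in-group index $b'\neq b$, $I_{\ell/s}\otimes L^{(r)}_{a,b',b}$; for the $c$-th part of $C_h$, $I_{\ell/s}\otimes L^{(r)}_{a,b,c}$ if $c=b$ and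 its negative with the same indices if $c\ne b$; for $z$ in a group $a'\ne a$, the matrix of the same form as $A^{(r)}_{a',b'}$ on indices without the digit $i_a$. For every set $\mathcal H$ of $d$ nodes other than $h$, $C_h$ is recovered linearly from $\{C_j(i): i_a=b,\ j\in\mathcal H\}$; the number of symbols downloaded and the number of symbols accessed both equal $d\ell/(d-k+1)$. (1b) Let $h=a(s+1)+s<n$. For each choice of the digits $i_u$, $u\ne a$, sum the $s$ block rows of the parity-check equations of $\mathcal C$ with these digits. The resulting equations are the parity-check equations, in the vectors $(C_z(i))_{i_a=b}$ for $z=a(s+1)+b$ with $b<s$, $(\sum_{e=0}^{s-1}C_z(i+es^a))_{i_a=0}$ for $z$ outside group $a$, and $(C_h(i))_{i_a=c}$, $0\le c<s$, of an $(n+s-1,k+s-1,\ell/s)$ MDS array code. Its parity-check matrices are, respectively, $I_{\ell/s}\otimes L^{(r)}_{a,b,b}$, the matrix of the same form as $A^{(r)}_{a',b'}$ on indices without the digit $i_a$ (for $z=a'(s+1)+b'$), and $I_{\ell/s}\otimes L^{(r)}_{a,s,c}$. For every set $\mathcal H$ of $d$ nodes other than $h$, $C_h$ is recovered linearly from $\{C_j(i):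 i_a=b\}$ for the helpers $j=a(s+1)+b\in\mathcal H$ in group $a$ together with $\{\sum_{e=0}^{s-1}C_j(i+es^a): i_a=0\}$ for the helpers $j\in\mathcal H$ outside group $a$; the number of symbols downloaded equals $d\ell/(d-k+1)$. This scheme is not optimal-access: it accesses all $\ell$ symbols of each helper outside group $a$, so that it accesses more than $d\ell/(d-k+1)$ symbols as soon as there is such a helper. (1c) $\mathcal C$ is an $(n,k,\ell)$ MSR code with repair degree $d$ and sub-packetization $\ell=s^{\lceil n/(s+1)\rceil}$. (2) For $n\ge1$, admissible scalars exist in every finite field with at least $(s+1)\lceil n/(s+1)\rceil s+\sum_{t=1}^{s+1}\binom{s+1}{t}\frac{st(t-1)}{2}$ elements. (3) A field of size linear in $n$ suffices: there is a constant $K_s$, depending only on $s$, such that for all $n,k,d$ as above there is a prime power $q\le K_s n$ such that over the field with $q$ elements there are admissible scalars for which $\mathcal C$ is an $(n,k,\ell)$ MSR code with repair degree $d$. -/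

import Mathlib

/-! Array codes: a codeword is a family `c : ν → ι → F`; `ν` indexes the nodes and `ι` the
symbols stored in one node, so the code length is `card ν` and the sub-packetization is
`card ι`. -/

/-- The array code given by the parity-check equations `∑ j, H j *ᵥ c j = 0`. -/
def arrayCode {F ν ι ρ : Type*} [Field F] [Fintype ν] [Fintype ι]
    (H : ν → Matrix ρ ι F) : Submodule F (ν → ι → F) where
  carrier := {c | ∑ j, (H j).mulVec (c j) = 0}
  add_mem' := by
    intro c c' hc hc'
    simp only [Set.mem_ofPred_eq, Pi.add_apply, Matrix.mulVec_add, Finset.sum_add_distrib] at *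
    rw [hc, hc', add_zero]
  zero_mem' := by simp
  smul_mem' := by
    intro x c hc
    simp only [Set.mem_ofPred_eq, Pi.smul_apply, Matrix.mulVec_smul, ← Finset.smul_sum] at *
    rw [hc, smul_zero]

/-- `C` is a `(card ν, k, card ι)` MDS array code: its dimension is `k * card ι`, and any `k`
nodes determine the whole codeword. -/
def IsMDSArrayCode {F ν ι : Type*} [Field F] [Fintype ι]
    (C : Submodule F (ν → ι → F)) (k : ℕ) : Prop :=
  Module.finrank F C = k * Fintype.card ι ∧
    ∀ S : Finset ν, S.card = k → ∀ c ∈ C, ∀ c' ∈ C, (∀ j ∈ S, c j = c' j) → c = c'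

/-- Node `h` can be recovered from the data `D j *ᵥ c j` sent by the helper nodes `j ∈ 𝓗`. -/
def Repairs {F ν ι : Type*} [Field F] [Fintype ι] (C : Submodule F (ν → ι → F))
    (h : ν) (𝓗 : Finset ν) {β : ν → Type*} (D : ∀ j, Matrix (β j) ι F) : Prop :=
  ∃ g : (∀ j : 𝓗, β j → F) →ₗ[F] (ι → F), ∀ c ∈ C, g (fun j => (D j).mulVec (c j)) = c h

/-- The number of symbols downloaded from the helper nodes in `𝓗`. -/
def repairBandwidth {F ν ι : Type*} (𝓗 : Finset ν) {β : ν → Type*} [∀ j, Fintype (β j)]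
    (_D : ∀ j, Matrix (β j) ι F) : ℕ :=
  ∑ j ∈ 𝓗, Fintype.card (β j)

/-- The symbols of a node that have to be read in order to compute `M *ᵥ c`. -/
def accessedSymbols {F β ι : Type*} [Field F] (M : Matrix β ι F) : Set ι :=
  {i | ∃ x, M x i ≠ 0}

/-- The number of symbols read in the helper nodes in `𝓗`. -/
noncomputable def repairAccess {F ν ι : Type*} [Field F] (𝓗 : Finset ν) {β : ν → Type*}
    (D : ∀ j, Matrix (β j) ι F) : ℕ :=
  ∑ j ∈ 𝓗, (accessedSymbols (D j)).ncard

/-- The cut-set bound `d ℓ / (d - k + 1)` on the repair bandwidth. -/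
def cutSetBound (k d ℓ : ℕ) : ℚ := (d : ℚ) * ℓ / ((d : ℚ) - k + 1)

/-- `C` is a `(card ν, k, ℓ)` MSR code with repair degree `d`. -/
def IsMSRCode {F ν ι : Type*} [Field F] [Fintype ι]
    (C : Submodule F (ν → ι → F)) (k d ℓ : ℕ) : Prop :=
  Fintype.card ι = ℓ ∧ IsMDSArrayCode C k ∧
    ∀ (h : ν) (𝓗 : Finset ν), h ∉ 𝓗 → 𝓗.card = d →
      ∃ (β : ν → ℕ) (D : ∀ j, Matrix (Fin (β j)) ι F),
        Repairs C h 𝓗 D ∧ (repairBandwidth 𝓗 D : ℚ) = cutSetBound k d ℓ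

/-! The construction. Symbol indices are written through their base-`s` digits, as functions
`G → Fin s` on the set `G` of digit positions. -/

/-- The block matrix with digit position `a` and in-group index `b`: the block entry at `(i, j)`
is the column `(μ (j a) ^ p)_{p < t}` if `i = j`, minus this column if `i a = b ≠ j a` and `i`, `j`
agree at all other positions, and zero otherwise. -/
def blockMatrix {F G : Type*} [Field F] [Fintype G] [DecidableEq G] {s : ℕ} (t : ℕ)
    (a : G) (b : Fin (s + 1)) (μ : Fin s → F) : Matrix ((G → Fin s) × Fin t) (G → Fin s) F :=
  fun ip j =>
    if ip.1 = j then μ (j a) ^ (ip.2 : ℕ)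
    else if (ip.1 a).castSucc = b ∧ (j a).castSucc ≠ b ∧ ∀ u, u ≠ a → ip.1 u = j u then
      -(μ (j a) ^ (ip.2 : ℕ))
    else 0

/-- `I ⊗ L`, where `L` is the column `(x ^ p)_{p < t}`. -/
def diagMatrix {F : Type*} [Field F] (X : Type*) [DecidableEq X] (t : ℕ) (x : F) :
    Matrix (X × Fin t) X F :=
  fun ip j => if ip.1 = j then x ^ (ip.2 : ℕ) else 0

/-- The number of groups `⌈n / (s + 1)⌉`. -/
def numGroups (n s : ℕ) : ℕ := n ⌈/⌉ (s + 1)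

theorem div_lt_numGroups {n s : ℕ} (j : Fin n) : (j : ℕ) / (s + 1) < numGroups n s := by
  have hj := j.isLt
  have e : n + (s + 1) - 1 = (n - 1) + (s + 1) := by omega
  rw [numGroups, Nat.ceilDiv_eq_add_pred_div, e, Nat.add_div_right _ (Nat.succ_pos s)]
  exact Nat.lt_succ_of_le (Nat.div_le_div_right (by omega))

/-- Node `j = a (s + 1) + b` belongs to group `a`. -/
def nodeGroup {n : ℕ} (s : ℕ) (j : Fin n) : Fin (numGroups n s) := ⟨j / (s + 1), div_lt_numGroups j⟩

/-- Node `j = a (s + 1) + b` has index `b` in its group. -/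
def nodePos {n : ℕ} (s : ℕ) (j : Fin n) : Fin (s + 1) :=
  ⟨j % (s + 1), Nat.mod_lt _ (Nat.succ_pos s)⟩

/-- Symbol indices `0 ≤ i < s ^ ⌈n / (s + 1)⌉`, as digit vectors. -/
abbrev SymbolIndex (n s : ℕ) : Type := Fin (numGroups n s) → Fin s

/-- The scalars of the construction, `lam (a, b, j)` being `λ_{a s (s + 1) + b s + j}`. -/
abbrev Scalars (F : Type*) (n s : ℕ) : Type _ := Fin (numGroups n s) × Fin (s + 1) × Fin s → F

/-- The square matrix `A_{a, B} = [A_{a, b₁} ⋯ A_{a, b_t}]` with `t = |B|` rows per block. -/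
def localMatrix {F : Type*} [Field F] {n s : ℕ} (lam : Scalars F n s)
    (a : Fin (numGroups n s)) (B : Finset (Fin (s + 1))) :
    Matrix (SymbolIndex n s × Fin B.card) (SymbolIndex n s × Fin B.card) F :=
  fun ip jq =>
    blockMatrix B.card a (B.orderEmbOfFin rfl jq.2)
      (fun e => lam (a, B.orderEmbOfFin rfl jq.2, e)) ip jq.1

/-- The scalars are distinct and satisfy the local constraints. -/
def Admissible {F : Type*} [Field F] {n s : ℕ} (lam : Scalars F n s) : Prop :=
  Function.Injective lam ∧ ∀ a B, (localMatrix lam a B).det ≠ 0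

/-- The parity-check matrix of node `j`. -/
def parityCheck {F : Type*} [Field F] {n s : ℕ} (lam : Scalars F n s) (r : ℕ) (j : Fin n) :
    Matrix (SymbolIndex n s × Fin r) (SymbolIndex n s) F :=
  blockMatrix r (nodeGroup s j) (nodePos s j) (fun e => lam (nodeGroup s j, nodePos s j, e))

/-- The code of the second construction with length `n` and redundancy `r`. -/
def secondCode {F : Type*} [Field F] {n s : ℕ} (lam : Scalars F n s) (r : ℕ) :
    Submodule F (Fin n → SymbolIndex n s → F) :=
  arrayCode (parityCheck lam r)

/-- Symbol indices with the digit at position `a` left out. -/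
abbrev RestIndex {n s : ℕ} (a : Fin (numGroups n s)) : Type :=
  {u : Fin (numGroups n s) // u ≠ a} → Fin s

/-- The symbol index with digit `e` at position `a` and the digits `x` elsewhere. -/
def insertDigit {n s : ℕ} (a : Fin (numGroups n s)) (e : Fin s) (x : RestIndex a) :
    SymbolIndex n s :=
  (Equiv.funSplitAt a (Fin s)).symm (e, x)

/-- Repair of a node in group `a` with in-group index `b < s`: each helper sends its symbols
whose index has digit `b` at position `a`. -/
def downloadFirst {n s : ℕ} (F : Type*) [Field F] (a : Fin (numGroups n s)) (b : Fin s)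
    (_j : Fin n) : Matrix (RestIndex a) (SymbolIndex n s) F :=
  fun x i => if i = insertDigit a b x then 1 else 0

/-- Repair of the last node of group `a`: a helper in group `a` with in-group index `b` sends its
symbols whose index has digit `b` at position `a`; a helper outside group `a` sends, for each
choice `x` of the other digits, the sum of its `s` symbols with these digits. -/
def downloadLast {n s : ℕ} (F : Type*) [Field F] (a : Fin (numGroups n s))
    (j : Fin n) : Matrix (RestIndex a) (SymbolIndex n s) F :=
  fun x i =>
    if ∃ e : Fin s, (nodeGroup s j = a → e.castSucc = nodePos s j) ∧ i = insertDigit a e x then 1 else 0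

/-- The `n + s - 1` nodes of the reduced code: the nodes other than `h`, and `s` parts of `h`. -/
abbrev ReducedNode {n : ℕ} (s : ℕ) (h : Fin n) : Type := {j : Fin n // j ≠ h} ⊕ Fin s

/-- The reduced word: the node `z ≠ h` is replaced by the data it sends, and the node `h` is split
into `s` parts according to the digit at the position of its group. -/
def reducedWord {F : Type*} [Field F] {n s : ℕ} (h : Fin n)
    (D : Fin n → Matrix (RestIndex (nodeGroup s h)) (SymbolIndex n s) F)
    (c : Fin n → SymbolIndex n s → F) : ReducedNode s h → RestIndex (nodeGroup s h) → F
  | Sum.inl z => (D z).mulVec (c z)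
  | Sum.inr e => fun x => c h (insertDigit (nodeGroup s h) e x)

/-- Reduced parity-check matrices for the repair of a node `h` with in-group index `b < s`. -/
def reducedCheckFirst {F : Type*} [Field F] {n s : ℕ} (lam : Scalars F n s) (r : ℕ) (h : Fin n)
    (b : Fin s) : ReducedNode s h →
      Matrix (RestIndex (nodeGroup s h) × Fin r) (RestIndex (nodeGroup s h)) F
  | Sum.inl z =>
      if hz : nodeGroup s z.1 ≠ nodeGroup s h then
        blockMatrix r ⟨nodeGroup s z.1, hz⟩ (nodePos s z.1) (fun e => lam (nodeGroup s z.1, nodePos s z.1, e))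
      else diagMatrix _ r (lam (nodeGroup s h, nodePos s z.1, b))
  | Sum.inr e =>
      if e = b then diagMatrix _ r (lam (nodeGroup s h, b.castSucc, e))
      else -diagMatrix _ r (lam (nodeGroup s h, b.castSucc, e))

/-- Reduced parity-check matrices for the repair of the last node `h` of a group. (The value `0`
is never taken then: a node `z ≠ h` of the same group has in-group index `< s`.) -/
def reducedCheckLast {F : Type*} [Field F] {n s : ℕ} (lam : Scalars F n s) (r : ℕ) (h : Fin n) :
    ReducedNode s h → Matrix (RestIndex (nodeGroup s h) × Fin r) (RestIndex (nodeGroup s h)) F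
  | Sum.inl z =>
      if hz : nodeGroup s z.1 ≠ nodeGroup s h then
        blockMatrix r ⟨nodeGroup s z.1, hz⟩ (nodePos s z.1) (fun e => lam (nodeGroup s z.1, nodePos s z.1, e))
      else if hp : (nodePos s z.1 : ℕ) < s then
        diagMatrix _ r (lam (nodeGroup s h, nodePos s z.1, ⟨nodePos s z.1, hp⟩))
      else 0
  | Sum.inr e => diagMatrix _ r (lam (nodeGroup s h, Fin.last s, e))

/-- The field size `(s + 1) ⌈n / (s + 1)⌉ s + ∑_{t = 1}^{s + 1} (s + 1 choose t) s t (t - 1) / 2`,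
which is `n s + ∑ …` when `s + 1` divides `n`. -/
def fieldSizeBound (n s : ℕ) : ℕ :=
  (s + 1) * numGroups n s * s +
    ∑ t ∈ Finset.Icc 1 (s + 1), (s + 1).choose t * (s * (t * (t - 1) / 2))

/-! The parity checks are a Vandermonde system with operator entries. On functions of digit vectors,
row `p` of node `(a, b)` acts as `M Λ ^ p`, where `Λ` is diagonal in digit `a` with entries
`λ_{a,b,e}` and `M` applies `foldMatrix` to digit `a`. Operators at different digit positions
commute, and distinct scalars make differences of `Λ` across groups injective.
`groupwise_kernel_trivial` then reduces the MDS property to one group at a time: a group `B` with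
trivial local kernel obeys a monic recurrence of order `|B|`, which eliminates it from the system
and leaves a system of the same shape for the other groups. Within a group, triviality is exactly
the determinant condition of admissibility.

For repair, the rows with digit `b` at position `a` (for in-group index `b < s`), or the sums of
rows over that digit (for index `s`), turn each other node of the failed node's group and each of
the `s` parts of the failed node into a scalar node `± I ⊗ L`. Nodes of other groups keep their form
on the remaining digits. Scalar nodes form singleton groups with new distinct scalars, so the same
theorem (`isMDSArrayCode_taggedCheck`) gives an MDS code with redundancy `n - k` and dimension
parameter `k + s - 1 = d`. Hence `d` helpers determine all parts of the failed node.

Admissible scalars are found group by group. The local determinants are nonzero polynomials, since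
scalars depending only on `b` reduce them to Vandermonde systems. Multiplied by the product of
differences, they give a polynomial of small degree in each variable, hence with a nonzero value on
the unused field elements. -/

/-! ### Vandermonde systems with operator entries -/

/-- A block of operators with trivial local kernel satisfies a monic operator recurrence whose
coefficients commute with everything that commutes with the block. -/
theorem exists_recurrence {F V ν : Type*} [Field F] [AddCommGroup V] [Module F V]
    [FiniteDimensional F V] (M Λ : ν → Module.End F V) (B : Finset ν)
    (hloc : ∀ c : ν → V, (∀ p < B.card, ∑ z ∈ B, M z ((Λ z ^ p) (c z)) = 0) → ∀ z ∈ B, c z = 0) :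
    (∀ f : ℕ → V, ∃ d : ν → V, ∀ p < B.card, ∑ z ∈ B, M z ((Λ z ^ p) (d z)) = f p) ∧
    ∃ Q : ℕ → Module.End F V,
      (∀ c : ν → V, ∑ q ∈ Finset.range B.card, Q q (∑ z ∈ B, M z ((Λ z ^ q) (c z))) =
        ∑ z ∈ B, M z ((Λ z ^ B.card) (c z))) ∧
      ∀ X : Module.End F V, (∀ z ∈ B, Commute X (M z) ∧ Commute X (Λ z)) →
        ∀ q, Commute X (Q q) := by
  classical
  let row : ℕ → (B → V) →ₗ[F] V := fun p => ∑ z : B, M z ∘ₗ (Λ z ^ p) ∘ₗ LinearMap.proj z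
  have hrow : ∀ p (c : ν → V), row p (fun z => c z) = ∑ z ∈ B, M z ((Λ z ^ p) (c z)) := by
    intro p c
    rw [← Finset.sum_coe_sort B]
    simp [row, LinearMap.sum_apply]
  have hrow' : ∀ p (c : B → V), row p c = ∑ z : B, M z ((Λ z ^ p) (c z)) := by
    intro p c
    simp [row, LinearMap.sum_apply]
  let Φ : (B → V) →ₗ[F] (Fin B.card → V) := LinearMap.pi fun p => row p
  have hinj : Function.Injective Φ := by
    rw [injective_iff_map_eq_zero]
    intro c hc
    have key := hloc (fun z => if h : z ∈ B then c ⟨z, h⟩ else 0) (by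
      intro p hp
      have h1 : row p c = 0 := congrFun hc ⟨p, hp⟩
      rw [← hrow, ← h1]
      congr 1
      ext z
      simp)
    ext z
    simpa using key z z.2
  have hfr : Module.finrank F (B → V) = Module.finrank F (Fin B.card → V) := by
    simp [Module.finrank_pi_fintype]
  -- As many rows as nodes: injectivity makes the local system bijective in finite dimension.
  let e : (B → V) ≃ₗ[F] (Fin B.card → V) := LinearMap.linearEquivOfInjective Φ hinj hfr
  have he : ∀ c, e c = Φ c := fun c => rfl
  have hX : ∀ X : Module.End F V, (∀ z ∈ B, Commute X (M z) ∧ Commute X (Λ z)) →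
      ∀ p (c : B → V), row p (fun z => X (c z)) = X (row p c) := by
    intro X h p c
    rw [hrow', hrow', map_sum]
    refine Finset.sum_congr rfl fun z _ => ?_
    have h1 := (h z z.2).1
    have h2 := (h z z.2).2.pow_right p
    have h3 : Commute X (M z * Λ z ^ p) := h1.mul_right h2
    exact (LinearMap.congr_fun h3.eq (c z)).symm
  -- Row `B.card` is expressed through the lower rows by inverting `Φ`; `Q q` is the coefficient of
  -- row `q`. Operators commuting with the block commute with `Φ` coordinatewise, hence with its
  -- inverse.
  refine ⟨fun f => ?_, fun q => if hq : q < B.card then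
    row B.card ∘ₗ e.symm.toLinearMap ∘ₗ LinearMap.single F (fun _ => V) ⟨q, hq⟩ else 0, ?_, ?_⟩
  · refine ⟨fun z => if h : z ∈ B then e.symm (fun p => f p) ⟨z, h⟩ else 0, fun p hp => ?_⟩
    rw [← hrow]
    have : e (e.symm (fun p => f p)) ⟨p, hp⟩ = f p := by rw [e.apply_symm_apply]
    rw [← this, he]
    change row p _ = row p _
    congr 1
    ext z
    simp
  · intro c
    rw [← hrow, ← Fin.sum_univ_eq_sum_range
      (fun q => (if hq : q < B.card then
        row B.card ∘ₗ e.symm.toLinearMap ∘ₗ LinearMap.single F (fun _ => V) ⟨q, hq⟩ else 0)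
        (∑ z ∈ B, M z ((Λ z ^ q) (c z))))]
    simp only [Fin.is_lt, dite_true, Fin.eta, LinearMap.comp_apply, ← hrow]
    rw [← map_sum, LinearEquiv.coe_coe, ← map_sum]
    congr 1
    rw [LinearEquiv.symm_apply_eq]
    rw [he]
    exact Finset.univ_sum_single fun q : Fin B.card => row q fun z => c z
  · intro X h q
    dsimp only
    split_ifs with hq
    · ext v
      change X (row _ (e.symm (Pi.single _ v))) = row _ (e.symm (Pi.single _ (X v)))
      rw [← hX X h]
      congr 1
      rw [LinearEquiv.eq_symm_apply, he]
      ext p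
      change row p _ = _
      rw [hX X h]
      have : row p (e.symm (Pi.single ⟨q, hq⟩ v)) = e (e.symm (Pi.single ⟨q, hq⟩ v)) p := rfl
      rw [this, e.apply_symm_apply]
      by_cases hp : p = ⟨q, hq⟩
      · subst hp; simp
      · simp [hp]
    · exact Commute.zero_right X

/-- If the nodes are partitioned into groups, operators of different groups commute, the
differences of `Λ` across groups are injective, and each group has trivial local kernels, then the
joint power system of any set of nodes has trivial kernel. -/
theorem groupwise_kernel_trivial {F V ν γ : Type*} [Field F] [AddCommGroup V] [Module F V]
    [FiniteDimensional F V] (g : ν → γ) (M Λ : ν → Module.End F V)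
    (hMM : ∀ z w, g z ≠ g w → Commute (M z) (M w))
    (hMΛ : ∀ z w, g z ≠ g w → Commute (M z) (Λ w))
    (hΛΛ : ∀ z w, g z ≠ g w → Commute (Λ z) (Λ w))
    (hdiff : ∀ z w, g z ≠ g w → ∀ v, Λ z v = Λ w v → v = 0)
    (hloc : ∀ B : Finset ν, (∀ z ∈ B, ∀ w ∈ B, g z = g w) → ∀ c : ν → V,
      (∀ p < B.card, ∑ z ∈ B, M z ((Λ z ^ p) (c z)) = 0) → ∀ z ∈ B, c z = 0)
    (S : Finset ν) (c : ν → V)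
    (hc : ∀ p < S.card, ∑ z ∈ S, M z ((Λ z ^ p) (c z)) = 0) : ∀ z ∈ S, c z = 0 := by
  classical
  induction hn : S.card using Nat.strong_induction_on generalizing S c with
  | _ n ih =>
  intro z₀ hz₀
  set B := S.filter (fun z => g z = g z₀) with hB
  set T := S.filter (fun z => ¬ g z = g z₀) with hT
  have hBS : B.card + T.card = S.card := Finset.card_filter_add_card_filter_not _
  have hz₀B : z₀ ∈ B := by simp [hB, hz₀]
  have hBpos : 0 < B.card := Finset.card_pos.2 ⟨z₀, hz₀B⟩
  have hne : ∀ w ∈ T, ∀ z ∈ B, g w ≠ g z := by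
    intro w hw z hz
    simp only [hB, hT, Finset.mem_filter] at hw hz
    rw [hz.2]
    exact hw.2
  have hBloc := hloc B (by
    intro z hz w hw
    simp only [hB, Finset.mem_filter] at hz hw
    rw [hz.2, hw.2])
  obtain ⟨hsol, Q, hQ, hQc⟩ := exists_recurrence M Λ B hBloc
  have hQM : ∀ w ∈ T, ∀ q, Commute (M w) (Q q) := fun w hw =>
    hQc _ fun z hz => ⟨hMM _ _ (hne w hw z hz), hMΛ _ _ (hne w hw z hz)⟩
  have hQΛ : ∀ w ∈ T, ∀ q, Commute (Λ w) (Q q) := fun w hw =>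
    hQc _ fun z hz => ⟨(hMΛ _ _ (hne w hw z hz).symm).symm, hΛΛ _ _ (hne w hw z hz)⟩
  have hsplit : ∀ p, ∑ z ∈ S, M z ((Λ z ^ p) (c z)) =
      ∑ z ∈ B, M z ((Λ z ^ p) (c z)) + ∑ z ∈ T, M z ((Λ z ^ p) (c z)) := fun p =>
    (Finset.sum_filter_add_sum_filter_not S _ _).symm
  -- The recurrence of `B`, applied to the rows of the whole system, kills the contribution of `B`
  -- and replaces `c w` by `c' w` for `w ∈ T`. It consumes `B.card` rows, so `T.card` rows remain.
  let c' : ν → V := fun w =>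
    (Λ w ^ B.card) (c w) - ∑ q ∈ Finset.range B.card, Q q ((Λ w ^ q) (c w))
  have hterm : ∀ p, ∀ w ∈ T, M w ((Λ w ^ p) (c' w)) = M w ((Λ w ^ (p + B.card)) (c w)) -
      ∑ q ∈ Finset.range B.card, Q q (M w ((Λ w ^ (p + q)) (c w))) := by
    intro p w hw
    simp only [c', map_sub, map_sum]
    congr 1
    · rw [pow_add]; rfl
    · refine Finset.sum_congr rfl fun q _ => ?_
      have h1 : Commute (M w * Λ w ^ p) (Q q) :=
        Commute.mul_left (hQM w hw q) ((hQΛ w hw q).pow_left p)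
      rw [pow_add]
      exact LinearMap.congr_fun h1.eq ((Λ w ^ q) (c w))
  have hB0 : ∀ p, ∑ z ∈ B, M z ((Λ z ^ (p + B.card)) (c z)) -
      ∑ q ∈ Finset.range B.card, Q q (∑ z ∈ B, M z ((Λ z ^ (p + q)) (c z))) = 0 := by
    intro p
    have := hQ (fun z => (Λ z ^ p) (c z))
    simp only [← Module.End.mul_apply, ← pow_add] at this
    simp only [add_comm p, ← Module.End.mul_apply]
    simp only [Module.End.mul_apply] at this ⊢
    rw [this, sub_self]
  have hc' : ∀ p < T.card, ∑ w ∈ T, M w ((Λ w ^ p) (c' w)) = 0 := by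
    intro p hp
    rw [Finset.sum_congr rfl (hterm p), Finset.sum_sub_distrib, Finset.sum_comm]
    simp only [← map_sum]
    have e1 : ∀ q ≤ B.card, ∑ w ∈ T, M w ((Λ w ^ (p + q)) (c w)) =
        -∑ w ∈ B, M w ((Λ w ^ (p + q)) (c w)) := by
      intro q hq
      have := hc (p + q) (by omega)
      rw [hsplit] at this
      exact eq_neg_of_add_eq_zero_right this
    have e2 : ∑ q ∈ Finset.range B.card, Q q (∑ w ∈ T, M w ((Λ w ^ (p + q)) (c w))) =
        -∑ q ∈ Finset.range B.card, Q q (∑ w ∈ B, M w ((Λ w ^ (p + q)) (c w))) := by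
      rw [← Finset.sum_neg_distrib]
      exact Finset.sum_congr rfl fun q hq => by rw [e1 q (Finset.mem_range.1 hq).le, map_neg]
    rw [e1 _ le_rfl, e2, ← neg_zero, ← hB0 p, neg_sub_neg, neg_sub]
  have hT0 := ih T.card (by omega) T c' hc' rfl
  have hTc : ∀ w ∈ T, c w = 0 := by
    intro w hw
    have hw' : (Λ w ^ B.card) (c w) = ∑ q ∈ Finset.range B.card, Q q ((Λ w ^ q) (c w)) :=
      sub_eq_zero.1 (hT0 w hw)
    -- It remains to deduce `c w = 0` from `c' w = 0`. The local system of `B` is solved with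
    -- right-hand sides `Λ w ^ p (c w)`; since `c' w = 0`, the solution `d` also fits row `B.card`.
    obtain ⟨d, hd⟩ := hsol fun p => (Λ w ^ p) (c w)
    have hd' : ∀ p ≤ B.card, ∑ z ∈ B, M z ((Λ z ^ p) (d z)) = (Λ w ^ p) (c w) := by
      intro p hp
      rcases hp.lt_or_eq with h | rfl
      · exact hd p h
      · rw [hw', ← hQ d]
        exact Finset.sum_congr rfl fun q hq => by rw [hd q (Finset.mem_range.1 hq)]
    -- Both `Λ z (d z)` and `Λ w (d z)` solve the local system with right-hand sides `Λ w ^ (p + 1)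
    -- (c w)`, so they agree. Injectivity of the difference gives `d = 0`, and row `0` gives `c w =
    -- 0`.
    have h0 := hBloc (fun z => Λ z (d z) - Λ w (d z)) (by
      intro p hp
      simp only [map_sub, Finset.sum_sub_distrib]
      have e1 : ∑ z ∈ B, M z ((Λ z ^ p) (Λ z (d z))) = (Λ w ^ (p + 1)) (c w) := by
        rw [← hd' (p + 1) hp]
        simp only [pow_succ]
        rfl
      have e2 : ∑ z ∈ B, M z ((Λ z ^ p) (Λ w (d z))) = Λ w ((Λ w ^ p) (c w)) := by
        rw [← hd' p hp.le, map_sum]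
        refine Finset.sum_congr rfl fun z hz => ?_
        have h1 : Commute (M z * Λ z ^ p) (Λ w) :=
          Commute.mul_left (hMΛ _ _ (hne w hw z hz).symm)
            ((hΛΛ _ _ (hne w hw z hz).symm).pow_left p)
        exact LinearMap.congr_fun h1.eq (d z)
      rw [e1, e2, pow_succ', sub_eq_zero]
      rfl)
    have h1 : ∀ z ∈ B, d z = 0 := fun z hz =>
      hdiff z w (hne w hw z hz).symm _ (sub_eq_zero.1 (h0 z hz))
    have h2 := hd' 0 (Nat.zero_le _)
    simpa [Finset.sum_eq_zero fun z hz => (by rw [h1 z hz, map_zero] : M z (d z) = 0)] using h2.symm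
  refine hBloc c (fun p hp => ?_) z₀ hz₀B
  have := hc p (by omega)
  rwa [hsplit, Finset.sum_eq_zero (s := T) (fun w hw => by rw [hTc w hw, map_zero, map_zero]),
    add_zero] at this

/-! ### From trivial kernels to the MDS property -/

/-- An array code with `r` parity-check rows per symbol in which the parity-check matrices of any
`r` nodes are jointly injective is MDS. -/
theorem isMDSArrayCode_of_kernel_trivial {F ν ι : Type*} [Field F] [Fintype ν] [Fintype ι]
    {r k : ℕ} (hk : k + r = Fintype.card ν) (H : ν → Matrix (ι × Fin r) ι F)
    (hH : ∀ S : Finset ν, S.card = r → ∀ c : ν → ι → F,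
      ∑ z ∈ S, (H z).mulVec (c z) = 0 → ∀ z ∈ S, c z = 0) :
    IsMDSArrayCode (arrayCode H) k := by
  classical
  constructor
  · let φ : (ν → ι → F) →ₗ[F] (ι × Fin r → F) :=
      ∑ z, (H z).mulVecLin ∘ₗ LinearMap.proj z
    have hφ : ∀ c, φ c = ∑ z, (H z).mulVec (c z) := by
      intro c
      simp [φ, LinearMap.sum_apply]
    have hker : arrayCode H = LinearMap.ker φ := by
      ext c
      rw [LinearMap.mem_ker, hφ]
      rfl
    -- Any `r` nodes already make the parity-check map surjective, which fixes the dimension of its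
    -- kernel.
    obtain ⟨S, hS⟩ := Finset.exists_subset_card_eq (s := (Finset.univ : Finset ν)) (n := r)
      (by rw [Finset.card_univ]; omega)
    have hSr := hS.2
    let ψ : (S → ι → F) →ₗ[F] (ι × Fin r → F) :=
      ∑ z : S, (H z).mulVecLin ∘ₗ LinearMap.proj z
    have hψ : ∀ c, ψ c = ∑ z : S, (H z).mulVec (c z) := by
      intro c
      simp [ψ, LinearMap.sum_apply]
    have ext_eq : ∀ c : S → ι → F, ∑ z ∈ S, (H z).mulVec
        ((fun z => if h : z ∈ S then c ⟨z, h⟩ else 0) z) = ψ c := by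
      intro c
      rw [hψ, ← Finset.sum_coe_sort S]
      refine Finset.sum_congr rfl fun z _ => ?_
      simp
    have hinj : Function.Injective ψ := by
      rw [injective_iff_map_eq_zero]
      intro c hc
      have := hH S hSr (fun z => if h : z ∈ S then c ⟨z, h⟩ else 0) (by rw [ext_eq, hc])
      ext z : 1
      simpa using this z z.2
    have hsurj : Function.Surjective ψ := by
      refine (LinearMap.injective_iff_surjective_of_finrank_eq_finrank ?_).1 hinj
      simp [Module.finrank_pi_fintype, hSr, mul_comm]
    have hφs : Function.Surjective φ := by
      intro y
      obtain ⟨c, rfl⟩ := hsurj y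
      refine ⟨fun z => if h : z ∈ S then c ⟨z, h⟩ else 0, ?_⟩
      rw [hφ, ← ext_eq]
      refine (Finset.sum_subset (Finset.subset_univ S) fun z _ hz => ?_).symm
      simp [hz]
    have h1 := LinearMap.finrank_range_add_finrank_ker φ
    rw [LinearMap.range_eq_top.2 hφs, finrank_top] at h1
    simp only [Module.finrank_pi_fintype, Module.finrank_self, Finset.sum_const, Finset.card_univ,
      smul_eq_mul, mul_one, Fintype.card_prod, Fintype.card_fin, ← hk] at h1
    rw [hker]
    linarith
  · intro S hS c hc c' hc' heq
    have hd : c - c' ∈ arrayCode H := Submodule.sub_mem _ hc hc'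
    have h0 : ∀ z ∈ S, (c - c') z = 0 := fun z hz => by simp [heq z hz]
    have h1 : ∑ z ∈ Sᶜ, (H z).mulVec ((c - c') z) = 0 := by
      have : ∑ z, (H z).mulVec ((c - c') z) = 0 := hd
      rw [← this]
      refine Finset.sum_subset (Finset.subset_univ _) fun z _ hz => ?_
      rw [h0 z (by simpa using hz), Matrix.mulVec_zero]
    have h2 := hH Sᶜ (by rw [Finset.card_compl]; omega) _ h1
    rw [← sub_eq_zero]
    ext z : 1
    by_cases hz : z ∈ S
    · exact h0 z hz
    · exact h2 z (by simpa using hz)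

/-! ### Operators acting on one digit -/

/-- The operator on functions of digit vectors that applies the matrix `K` to the digit at
position `a`. -/
def digitOp {F G : Type*} [Field F] [DecidableEq G] {s : ℕ} (a : G)
    (K : Matrix (Fin s) (Fin s) F) : Module.End F ((G → Fin s) → F) where
  toFun f i := ∑ e, K (i a) e * f (Function.update i a e)
  map_add' f g := by
    ext i
    simp [mul_add, Finset.sum_add_distrib]
  map_smul' x f := by
    ext i
    simp only [Pi.smul_apply, smul_eq_mul, RingHom.id_apply, Finset.mul_sum]
    exact Finset.sum_congr rfl fun e _ => by ring

/-- The matrix that subtracts all other coordinates from coordinate `b`; it is the identity for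
`b = s`. -/
def foldMatrix (R : Type*) [CommRing R] {s : ℕ} (b : Fin (s + 1)) :
    Matrix (Fin s) (Fin s) R :=
  fun i e => if i = e then 1 else if i.castSucc = b then -1 else 0

section digitOp

variable {F G : Type*} [Field F] [DecidableEq G] {s : ℕ}

theorem digitOp_apply (a : G) (K : Matrix (Fin s) (Fin s) F) (f : (G → Fin s) → F)
    (i : G → Fin s) : digitOp a K f i = ∑ e, K (i a) e * f (Function.update i a e) := rfl

theorem digitOp_update (a : G) (K : Matrix (Fin s) (Fin s) F) (f : (G → Fin s) → F)
    (i : G → Fin s) (e : Fin s) : digitOp a K f (Function.update i a e) =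
      K.mulVec (fun e' => f (Function.update i a e')) e := by
  simp [digitOp_apply, Matrix.mulVec, dotProduct]

theorem digitOp_comp_eval (a : G) (K : Matrix (Fin s) (Fin s) F) (w : Fin s → F)
    (i : G → Fin s) : digitOp a K (fun j => w (j a)) i = K.mulVec w (i a) := by
  simp [digitOp_apply, Matrix.mulVec, dotProduct]

theorem digitOp_commute {a a' : G} (h : a ≠ a') (K K' : Matrix (Fin s) (Fin s) F) :
    Commute (digitOp a K) (digitOp a' K') := by
  refine LinearMap.ext fun f => funext fun i => ?_
  simp only [Module.End.mul_apply, digitOp_apply, Function.update_of_ne h, Function.update_of_ne h.symm,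
    Finset.mul_sum]
  rw [Finset.sum_comm]
  refine Finset.sum_congr rfl fun e _ => Finset.sum_congr rfl fun e' _ => ?_
  rw [Function.update_comm h]
  ring

theorem digitOp_mul (a : G) (K K' : Matrix (Fin s) (Fin s) F) :
    digitOp a (K * K') = digitOp a K * digitOp a K' := by
  refine LinearMap.ext fun f => funext fun i => ?_
  simp only [Module.End.mul_apply, digitOp_apply, Matrix.mul_apply, Function.update_self,
    Function.update_idem, Finset.mul_sum, Finset.sum_mul]
  rw [Finset.sum_comm]
  exact Finset.sum_congr rfl fun e _ => Finset.sum_congr rfl fun e' _ => by ring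

theorem digitOp_diagonal (a : G) (μ : Fin s → F) (f : (G → Fin s) → F) (i : G → Fin s) :
    digitOp a (Matrix.diagonal μ) f i = μ (i a) * f i := by
  rw [digitOp_apply, Finset.sum_eq_single (i a)]
  · simp
  · intro e _ he
    simp [Matrix.diagonal_apply_ne' _ he]
  · simp

theorem digitOp_diagonal_pow (a : G) (μ : Fin s → F) (p : ℕ) :
    digitOp a (Matrix.diagonal μ) ^ p = digitOp a (Matrix.diagonal fun e => μ e ^ p) := by
  induction p with
  | zero =>
    refine LinearMap.ext fun f => funext fun i => ?_
    simp only [pow_zero, Module.End.one_apply, digitOp_diagonal, one_mul]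
  | succ p ih =>
    rw [pow_succ, ih, ← digitOp_mul, Matrix.diagonal_mul_diagonal]
    simp only [pow_succ]

/-- Row `i` is supported on the columns agreeing with `i` off position `a`, so the sum runs over the
digit at `a` only. -/
theorem blockMatrix_mulVec [Fintype G] (t : ℕ) (a : G) (b : Fin (s + 1)) (μ : Fin s → F)
    (f : (G → Fin s) → F) (i : G → Fin s) (p : Fin t) :
    (blockMatrix t a b μ).mulVec f (i, p) =
      ∑ e, foldMatrix F b (i a) e * (μ e ^ (p : ℕ) * f (Function.update i a e)) := by
  symm
  unfold Matrix.mulVec dotProduct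
  refine Finset.sum_of_injOn (Function.update i a) (Function.update_injective i a).injOn
    (by simp) ?_ ?_
  · intro j _ hj
    have hj' : ∀ e, Function.update i a e ≠ j := by simpa using hj
    have h1 : i ≠ j := fun h => hj' (i a) (by simpa using h)
    have h2 : ¬ ∀ u, u ≠ a → i u = j u := by
      intro h
      refine hj' (j a) (funext fun u => ?_)
      by_cases hu : u = a
      · subst hu; simp
      · simp [hu, h u hu]
    simp [blockMatrix, h1, h2]
  · intro e _
    by_cases he : i a = e
    · subst he
      simp [blockMatrix, foldMatrix]
    · have h1 : i ≠ Function.update i a e := fun h => he (by simpa using congrFun h a)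
      have h2 : ∀ u, u ≠ a → i u = Function.update i a e u := fun u hu => by simp [hu]
      by_cases hb : (i a).castSucc = b
      · have hb' : e.castSucc ≠ b := fun h => he (Fin.castSucc_injective _ (hb.trans h.symm))
        simp only [blockMatrix, foldMatrix, if_neg he, if_neg h1, if_pos hb]
        rw [if_pos ⟨hb, by simpa using hb', h2⟩, Function.update_self, neg_one_mul, neg_mul]
      · simp [blockMatrix, foldMatrix, he, h1, hb]

/-- This brings the parity checks into the form `M (Λ ^ p)` required by `groupwise_kernel_trivial`.
-/
theorem blockMatrix_mulVec_eq_digitOp [Fintype G] (t : ℕ) (a : G) (b : Fin (s + 1)) (μ : Fin s → F)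
    (f : (G → Fin s) → F) (i : G → Fin s) (p : Fin t) :
    (blockMatrix t a b μ).mulVec f (i, p) =
      digitOp a (foldMatrix F b) ((digitOp a (Matrix.diagonal μ) ^ (p : ℕ)) f) i := by
  rw [blockMatrix_mulVec, digitOp_apply, digitOp_diagonal_pow]
  simp [digitOp_diagonal]

end digitOp

/-! ### The local constraint on a single digit -/

/-- The local constraint of a set `B` of in-group indices, on a single digit. -/
def LocallyIndependent {F : Type*} [Field F] {s : ℕ} (μ : Fin (s + 1) → Fin s → F)
    (B : Finset (Fin (s + 1))) : Prop :=
  ∀ w : Fin (s + 1) → Fin s → F,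
    (∀ p < B.card, ∑ b ∈ B, (foldMatrix F b).mulVec (fun e => μ b e ^ p * w b e) = 0) →
      ∀ b ∈ B, w b = 0

/-- With all digits other than the one at `a` frozen, the system decouples into copies of the
single-digit system. -/
theorem LocallyIndependent.digitOp {F G : Type*} [Field F] [DecidableEq G] {s : ℕ}
    {μ : Fin (s + 1) → Fin s → F} {B : Finset (Fin (s + 1))} (hB : LocallyIndependent μ B) (a : G)
    (c : Fin (s + 1) → (G → Fin s) → F)
    (hc : ∀ p < B.card, ∑ b ∈ B, digitOp a (foldMatrix F b)
      ((digitOp a (Matrix.diagonal (μ b)) ^ p) (c b)) = 0) : ∀ b ∈ B, c b = 0 := by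
  intro b hb
  ext i
  have := hB (fun b e => c b (Function.update i a e)) (by
    intro p hp
    ext e
    have h := congrFun (hc p hp) (Function.update i a e)
    rw [Finset.sum_apply] at h ⊢
    rw [Pi.zero_apply] at h ⊢
    rw [← h]
    refine Finset.sum_congr rfl fun b _ => ?_
    rw [digitOp_update, digitOp_diagonal_pow]
    simp [digitOp_diagonal]) b hb
  simpa using congrFun this (i a)

theorem sum_orderEmbOfFin {α M : Type*} [LinearOrder α] [AddCommMonoid M] (B : Finset α)
    (f : α → M) : ∑ q : Fin B.card, f (B.orderEmbOfFin rfl q) = ∑ b ∈ B, f b := by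
  rw [← Finset.sum_coe_sort B, ← (B.orderIsoOfFin rfl).toEquiv.sum_comp]
  rfl

theorem exists_orderEmbOfFin_eq {α : Type*} [LinearOrder α] (B : Finset α) {b : α} (hb : b ∈ B) :
    ∃ q, B.orderEmbOfFin rfl q = b := by
  have := B.range_orderEmbOfFin rfl
  rw [Set.ext_iff] at this
  exact (this b).2 hb

theorem localMatrix_mulVec {F : Type*} [Field F] {n s : ℕ} (lam : Scalars F n s)
    (a : Fin (numGroups n s)) (B : Finset (Fin (s + 1)))
    (c : Fin (s + 1) → SymbolIndex n s → F) (i : SymbolIndex n s) (p : Fin B.card) :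
    (localMatrix lam a B).mulVec (fun jq => c (B.orderEmbOfFin rfl jq.2) jq.1) (i, p) =
      (∑ b ∈ B, digitOp a (foldMatrix F b)
        ((digitOp a (Matrix.diagonal fun e => lam (a, b, e)) ^ (p : ℕ)) (c b))) i := by
  rw [Finset.sum_apply, ← sum_orderEmbOfFin]
  simp only [← blockMatrix_mulVec_eq_digitOp]
  rw [Matrix.mulVec, dotProduct, Fintype.sum_prod_type_right]
  rfl

theorem eq_comp_orderEmbOfFin {F X : Type*} [Zero F] {s : ℕ} (B : Finset (Fin (s + 1)))
    (v : X × Fin B.card → F) :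
    ∃ c : Fin (s + 1) → X → F, v = fun jq => c (B.orderEmbOfFin rfl jq.2) jq.1 := by
  refine ⟨fun b x => Function.extend (B.orderEmbOfFin rfl) (fun q => v (x, q)) 0 b, ?_⟩
  ext ⟨x, q⟩
  exact ((B.orderEmbOfFin rfl).injective.extend_apply (fun q => v (x, q)) 0 q).symm

/-- A single-digit kernel vector lifts to one depending only on `i a`; conversely a kernel vector
restricts to single-digit kernel vectors by freezing the other digits. -/
theorem localMatrix_det_ne_zero_iff {F : Type*} [Field F] {n s : ℕ} (lam : Scalars F n s)
    (a : Fin (numGroups n s)) (B : Finset (Fin (s + 1))) :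
    (localMatrix lam a B).det ≠ 0 ↔ LocallyIndependent (fun b e => lam (a, b, e)) B := by
  rw [Ne, ← Matrix.exists_mulVec_eq_zero_iff]
  push Not
  constructor
  · intro h w hw b hb
    by_contra hne
    obtain ⟨q, hq⟩ := exists_orderEmbOfFin_eq B hb
    obtain ⟨e, he⟩ := Function.ne_iff.1 hne
    refine h (fun jq => w (B.orderEmbOfFin rfl jq.2) (jq.1 a)) ?_ ?_
    · intro h0
      refine he ?_
      have := congrFun h0 (fun _ => e, q)
      simpa [hq] using this
    · ext ⟨i, p⟩
      have := localMatrix_mulVec lam a B (fun b j => w b (j a)) i p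
      rw [this, Finset.sum_apply, Pi.zero_apply]
      have h2 := congrFun (hw p p.2) (i a)
      rw [Finset.sum_apply, Pi.zero_apply] at h2
      rw [← h2]
      refine Finset.sum_congr rfl fun b _ => ?_
      rw [digitOp_diagonal_pow, ← digitOp_comp_eval a]
      refine congrFun (congrArg _ (funext fun j => ?_)) i
      rw [digitOp_diagonal]
  · intro h v hv hv0
    obtain ⟨c, rfl⟩ := eq_comp_orderEmbOfFin B v
    refine hv ?_
    have := h.digitOp a c (by
      intro p hp
      ext i
      rw [← localMatrix_mulVec lam a B c i ⟨p, hp⟩, hv0]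
      rfl)
    ext ⟨j, q⟩
    simp [this _ (B.orderEmbOfFin_mem rfl q)]

/-! ### MDS codes from block nodes and scalar nodes -/

/-- Parity-check matrix of a generalized node: either the block of a position and an in-group
index, or a nonzero multiple of `I ⊗ L`. -/
def taggedCheck {F G : Type*} [Field F] [Fintype G] [DecidableEq G] {s : ℕ} (r : ℕ)
    (μ : G → Fin (s + 1) → Fin s → F) (ε : F) :
    (G × Fin (s + 1)) ⊕ F → Matrix ((G → Fin s) × Fin r) (G → Fin s) F
  | Sum.inl ab => blockMatrix r ab.1 ab.2 (μ ab.1 ab.2)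
  | Sum.inr x => ε • diagMatrix _ r x

theorem diagMatrix_mulVec {F X : Type*} [Field F] [DecidableEq X] [Fintype X] (t : ℕ) (x : F)
    (f : X → F) (i : X) (p : Fin t) :
    (diagMatrix X t x).mulVec f (i, p) = x ^ (p : ℕ) * f i := by
  simp [Matrix.mulVec, dotProduct, diagMatrix]

/-- Generalized nodes with distinct tags and distinct scalars form an MDS array code. -/
theorem isMDSArrayCode_taggedCheck {F G ν : Type*} [Field F] [Fintype G] [DecidableEq G]
    [Fintype ν] {s r k : ℕ} (hk : k + r = Fintype.card ν)
    (μ : G → Fin (s + 1) → Fin s → F) (hμ : ∀ a B, LocallyIndependent (μ a) B)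
    (hinj : ∀ a a' b b' e e', μ a b e = μ a' b' e' → a = a')
    (τ : ν → (G × Fin (s + 1)) ⊕ F) (hτ : Function.Injective τ)
    (hτμ : ∀ z x, τ z = Sum.inr x → ∀ a b e, μ a b e ≠ x)
    (ε : ν → F) (hε : ∀ z, ε z ≠ 0) :
    IsMDSArrayCode (arrayCode fun z => taggedCheck r μ (ε z) (τ z)) k := by
  classical
  refine isMDSArrayCode_of_kernel_trivial hk _ fun S hS c hc => ?_
  -- Block nodes are grouped by digit position; each scalar is a group of its own.
  let g : ν → G ⊕ F := fun z => Sum.map Prod.fst id (τ z)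
  let M : ν → Module.End F ((G → Fin s) → F) := fun z =>
    Sum.elim (fun ab => digitOp ab.1 (foldMatrix F ab.2)) (fun _ => ε z • 1) (τ z)
  let Λ : ν → Module.End F ((G → Fin s) → F) := fun z =>
    Sum.elim (fun ab => digitOp ab.1 (Matrix.diagonal (μ ab.1 ab.2))) (fun x => x • 1) (τ z)
  have hscal : ∀ (x : F) (X : Module.End F ((G → Fin s) → F)), Commute (x • 1) X := fun x X =>
    (Commute.one_left X).smul_left x
  have hcheck : ∀ z f i (p : Fin r), (taggedCheck r μ (ε z) (τ z)).mulVec f (i, p) =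
      M z ((Λ z ^ (p : ℕ)) f) i := by
    intro z f i p
    simp only [M, Λ]
    rcases τ z with ⟨a, b⟩ | x
    · exact blockMatrix_mulVec_eq_digitOp r a b _ f i p
    · simp [taggedCheck, Matrix.smul_mulVec, diagMatrix_mulVec, smul_pow, mul_left_comm]
  refine groupwise_kernel_trivial g M Λ ?_ ?_ ?_ ?_ ?_ S c ?_
  · intro z w
    simp only [g, M]
    rcases τ z with ⟨a, b⟩ | x <;> rcases τ w with ⟨a', b'⟩ | x' <;> intro h
    · exact digitOp_commute (by simpa using h) _ _
    · exact (hscal _ _).symm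
    · exact hscal _ _
    · exact hscal _ _
  · intro z w
    simp only [g, M, Λ]
    rcases τ z with ⟨a, b⟩ | x <;> rcases τ w with ⟨a', b'⟩ | x' <;> intro h
    · exact digitOp_commute (by simpa using h) _ _
    · exact (hscal _ _).symm
    · exact hscal _ _
    · exact hscal _ _
  · intro z w
    simp only [g, Λ]
    rcases τ z with ⟨a, b⟩ | x <;> rcases τ w with ⟨a', b'⟩ | x' <;> intro h
    · exact digitOp_commute (by simpa using h) _ _
    · exact (hscal _ _).symm
    · exact hscal _ _
    · exact hscal _ _
  · intro z w
    have hz := hτμ z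
    have hw := hτμ w
    simp only [g, Λ]
    generalize τ z = tz at hz ⊢
    generalize τ w = tw at hw ⊢
    rcases tz with ⟨a, b⟩ | x <;> rcases tw with ⟨a', b'⟩ | x' <;> intro h v hv <;> ext i <;>
      have hi := congrFun hv i <;>
      simp only [Sum.elim_inl, Sum.elim_inr, digitOp_diagonal, LinearMap.smul_apply,
        Module.End.one_apply, Pi.smul_apply, smul_eq_mul] at hi <;>
      refine (mul_eq_mul_right_iff.1 hi).resolve_left fun h' => ?_
    · exact h (by simp [hinj _ _ _ _ _ _ h'])
    · exact hw x' rfl _ _ _ h'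
    · exact hz x rfl _ _ _ h'.symm
    · exact h (by simp [h'])
  · intro B hB c hc z hz
    cases hτz : τ z with
    | inr x =>
      -- By injectivity of the tags a scalar group is a singleton, and row `0` reads `ε z • c z =
      -- 0`.
      have : B = {z} := by
        ext w
        simp only [Finset.mem_singleton]
        refine ⟨fun hw => hτ ?_, fun h => h ▸ hz⟩
        have := hB w hw z hz
        simp only [g, hτz] at this
        rw [hτz]
        rcases hw : τ w with ⟨a, b⟩ | y
        · simp [hw] at this
        · simpa [hw] using this
      subst this
      have := hc 0 (by simp)
      simpa [M, hτz, hε z] using this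
    | inl ab =>
      obtain ⟨a, b⟩ := ab
      have hB' : ∀ w ∈ B, ∃ b', τ w = Sum.inl (a, b') := by
        intro w hw
        have := hB w hw z hz
        simp only [g, hτz] at this
        rcases hw : τ w with ⟨a', b'⟩ | y
        · simp only [hw, Sum.map_inl, Sum.inl.injEq] at this
          subst this
          exact ⟨b', rfl⟩
        · simp [hw] at this
      choose! f hf using hB'
      -- Within one position, distinct tags mean distinct in-group indices, so the nodes of `B` can
      -- be relabelled by the set `B.image f`.
      have hfinj : Set.InjOn f B := fun w hw w' hw' h => hτ (by rw [hf w hw, hf w' hw', h])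
      have hcard : (B.image f).card = B.card := Finset.card_image_of_injOn hfinj
      have : Nonempty ν := ⟨z⟩
      have hinv : ∀ w ∈ B, Function.invFunOn f B (f w) = w := fun w hw =>
        hfinj.leftInvOn_invFunOn hw
      have := (hμ a (B.image f)).digitOp a (fun b' => c (Function.invFunOn f B b')) (by
        intro p hp
        rw [hcard] at hp
        rw [Finset.sum_image hfinj, ← hc p hp]
        refine Finset.sum_congr rfl fun w hw => ?_
        rw [hinv w hw]
        simp only [M, Λ, hf w hw, Sum.elim_inl]) (f z) (Finset.mem_image_of_mem f hz)
      rwa [hinv z hz] at this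
  · intro p hp
    rw [hS] at hp
    ext i
    have h := congrFun hc (i, ⟨p, hp⟩)
    rw [Finset.sum_apply] at h ⊢
    rw [Pi.zero_apply] at h ⊢
    rw [← h]
    exact Finset.sum_congr rfl fun z _ => (hcheck z (c z) i ⟨p, hp⟩).symm

/-! ### Splitting off one digit, and the downloaded data -/

section insertDigit

variable {n s : ℕ} {a : Fin (numGroups n s)}

@[simp]
theorem insertDigit_self (e : Fin s) (x : RestIndex a) : insertDigit a e x a = e := by
  simp [insertDigit, Equiv.funSplitAt_symm_apply]

theorem insertDigit_of_ne (e : Fin s) (x : RestIndex a) {u : Fin (numGroups n s)} (hu : u ≠ a) :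
    insertDigit a e x u = x ⟨u, hu⟩ := by
  simp [insertDigit, Equiv.funSplitAt_symm_apply, hu]

theorem insertDigit_eta (i : SymbolIndex n s) : insertDigit a (i a) (fun u => i u) = i := by
  ext u
  by_cases hu : u = a
  · subst hu; simp
  · rw [insertDigit_of_ne _ _ hu]

theorem insertDigit_inj {e e' : Fin s} {x x' : RestIndex a} :
    insertDigit a e x = insertDigit a e' x' ↔ e = e' ∧ x = x' := by
  rw [insertDigit, insertDigit, Equiv.apply_eq_iff_eq, Prod.mk.injEq]

theorem update_insertDigit_self (e e' : Fin s) (x : RestIndex a) :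
    Function.update (insertDigit a e x) a e' = insertDigit a e' x := by
  ext u
  by_cases hu : u = a
  · subst hu; simp
  · rw [Function.update_of_ne hu, insertDigit_of_ne _ _ hu, insertDigit_of_ne _ _ hu]

theorem update_insertDigit_of_ne (e e' : Fin s) (x : RestIndex a) {u : Fin (numGroups n s)}
    (hu : u ≠ a) : Function.update (insertDigit a e x) u e' =
      insertDigit a e (Function.update x ⟨u, hu⟩ e') := by
  ext v
  by_cases hv : v = u
  · subst hv; simp [insertDigit_of_ne _ _ hu]
  · rw [Function.update_of_ne hv]
    by_cases hva : v = a
    · subst hva; simp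
    · rw [insertDigit_of_ne _ _ hva, insertDigit_of_ne _ _ hva, Function.update_of_ne]
      simpa using hv

variable {F : Type*} [Field F]

theorem blockMatrix_mulVec_insertDigit_of_ne (t : ℕ) {u : Fin (numGroups n s)} (hu : u ≠ a)
    (b : Fin (s + 1)) (μ : Fin s → F) (f : SymbolIndex n s → F) (e : Fin s) (x : RestIndex a)
    (p : Fin t) : (blockMatrix t u b μ).mulVec f (insertDigit a e x, p) =
      (blockMatrix t (⟨u, hu⟩ : {u // u ≠ a}) b μ).mulVec (fun y => f (insertDigit a e y))
        (x, p) := by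
  simp only [blockMatrix_mulVec, update_insertDigit_of_ne _ _ _ hu, insertDigit_of_ne _ _ hu]

theorem blockMatrix_mulVec_insertDigit_self (t : ℕ) (b : Fin (s + 1)) (μ : Fin s → F)
    (f : SymbolIndex n s → F) (e : Fin s) (x : RestIndex a) (p : Fin t) :
    (blockMatrix t a b μ).mulVec f (insertDigit a e x, p) =
      ∑ e', foldMatrix F b e e' * (μ e' ^ (p : ℕ) * f (insertDigit a e' x)) := by
  simp only [blockMatrix_mulVec, update_insertDigit_self, insertDigit_self]

theorem foldMatrix_of_castSucc_ne {b : Fin (s + 1)} {e : Fin s} (h : e.castSucc ≠ b) (e' : Fin s) :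
    foldMatrix F b e e' = if e = e' then 1 else 0 := by
  simp [foldMatrix, h]

/-- In a column `e' ≠ b` the diagonal `1` cancels against the `-1` in row `b`. This is why summing
block rows isolates one digit of each surviving node in the group. -/
theorem sum_foldMatrix_castSucc (b e' : Fin s) :
    ∑ e, foldMatrix F b.castSucc e e' = if e' = b then 1 else 0 := by
  by_cases h : e' = b
  · subst h
    rw [Finset.sum_eq_single e'] <;> simp +contextual [foldMatrix]
  · rw [if_neg h, Fintype.sum_eq_add e' b h]
    · simp [foldMatrix, Ne.symm h]
    · rintro x ⟨h1, h2⟩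
      simp [foldMatrix, h1, h2]

theorem downloadFirst_mulVec (b : Fin s) (j : Fin n) (f : SymbolIndex n s → F) :
    (downloadFirst F a b j).mulVec f = fun x => f (insertDigit a b x) := by
  ext x
  simp [Matrix.mulVec, dotProduct, downloadFirst]

theorem downloadLast_mulVec_of_eq {j : Fin n} (hj : nodeGroup s j = a) {b : Fin s}
    (hb : b.castSucc = nodePos s j) (f : SymbolIndex n s → F) :
    (downloadLast F a j).mulVec f = fun x => f (insertDigit a b x) := by
  ext x
  have : ∀ i, (∃ e : Fin s, (nodeGroup s j = a → e.castSucc = nodePos s j) ∧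
      i = insertDigit a e x) ↔ i = insertDigit a b x := by
    intro i
    constructor
    · rintro ⟨e, he, rfl⟩
      rw [Fin.castSucc_injective _ ((he hj).trans hb.symm)]
    · rintro rfl
      exact ⟨b, fun _ => hb, rfl⟩
  simp [Matrix.mulVec, dotProduct, downloadLast, this]

theorem downloadLast_of_ne {j : Fin n} (hj : nodeGroup s j ≠ a) (x : RestIndex a)
    (i : SymbolIndex n s) :
    downloadLast F a j x i = if ∃ e, i = insertDigit a e x then 1 else 0 := by
  simp [downloadLast, hj]

theorem downloadLast_mulVec_of_ne {j : Fin n} (hj : nodeGroup s j ≠ a)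
    (f : SymbolIndex n s → F) :
    (downloadLast F a j).mulVec f = fun x => ∑ e, f (insertDigit a e x) := by
  ext x
  symm
  refine Finset.sum_of_injOn (fun e => insertDigit a e x) ?_ (by simp) ?_ ?_
  · intro e _ e' _ h
    exact (insertDigit_inj.1 h).1
  · intro i _ hi
    have : ¬ ∃ e, i = insertDigit a e x := by
      rintro ⟨e, rfl⟩
      exact hi ⟨e, by simp, rfl⟩
    simp only [downloadLast_of_ne hj, if_neg this, zero_mul]
  · intro e _
    have : ∃ e', insertDigit a e x = insertDigit a e' x := ⟨e, rfl⟩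
    simp only [downloadLast_of_ne hj, if_pos this, one_mul]

end insertDigit

/-! ### The reduced codes -/

theorem node_ext {n s : ℕ} {j j' : Fin n} (hg : nodeGroup s j = nodeGroup s j')
    (hp : nodePos s j = nodePos s j') : j = j' := by
  have h1 : (j : ℕ) / (s + 1) = j' / (s + 1) := congrArg Fin.val hg
  have h2 : (j : ℕ) % (s + 1) = j' % (s + 1) := congrArg Fin.val hp
  ext
  rw [← Nat.div_add_mod (j : ℕ) (s + 1), h1, h2, Nat.div_add_mod]

section reducedTag

variable {F : Type*} {n s : ℕ}

/-- The tag of a reduced node: nodes of the group of `h` carry the scalar with digit `f`, and the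
parts of `h` carry the scalars of `h`. -/
def reducedTag (lam : Scalars F n s) (h : Fin n) (f : {j : Fin n // j ≠ h} → Fin s) :
    ReducedNode s h → ({u // u ≠ nodeGroup s h} × Fin (s + 1)) ⊕ F
  | Sum.inl z => if hz : nodeGroup s z.1 ≠ nodeGroup s h then
      Sum.inl (⟨nodeGroup s z.1, hz⟩, nodePos s z.1)
      else Sum.inr (lam (nodeGroup s h, nodePos s z.1, f z))
  | Sum.inr e => Sum.inr (lam (nodeGroup s h, nodePos s h, e))

theorem reducedTag_inl_of_ne (lam : Scalars F n s) {h : Fin n} (f : {j : Fin n // j ≠ h} → Fin s)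
    {z : {j : Fin n // j ≠ h}} (hz : nodeGroup s z.1 ≠ nodeGroup s h) :
    reducedTag lam h f (Sum.inl z) = Sum.inl (⟨nodeGroup s z.1, hz⟩, nodePos s z.1) :=
  dif_pos hz

theorem reducedTag_inl_of_eq (lam : Scalars F n s) {h : Fin n} (f : {j : Fin n // j ≠ h} → Fin s)
    {z : {j : Fin n // j ≠ h}} (hz : nodeGroup s z.1 = nodeGroup s h) :
    reducedTag lam h f (Sum.inl z) = Sum.inr (lam (nodeGroup s h, nodePos s z.1, f z)) :=
  dif_neg (not_not.2 hz)

theorem reducedTag_inr (lam : Scalars F n s) (h : Fin n) (f : {j : Fin n // j ≠ h} → Fin s)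
    (e : Fin s) :
    reducedTag lam h f (Sum.inr e) = Sum.inr (lam (nodeGroup s h, nodePos s h, e)) := rfl

/-- Whatever digits `f` selects, scalars of two nodes in the group differ in the in-group index and
scalars of two parts of `h` differ in the digit. -/
theorem reducedTag_injective {lam : Scalars F n s} (hlam : Function.Injective lam) (h : Fin n)
    (f : {j : Fin n // j ≠ h} → Fin s) : Function.Injective (reducedTag lam h f) := by
  have hne : ∀ (z : {j : Fin n // j ≠ h}) e e', nodeGroup s z.1 = nodeGroup s h →
      lam (nodeGroup s h, nodePos s z.1, e) ≠ lam (nodeGroup s h, nodePos s h, e') := by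
    intro z e e' hz h'
    exact z.2 (node_ext hz (Prod.mk.inj (Prod.mk.inj (hlam h')).2).1)
  rintro (z | e) (z' | e') hzz
  · by_cases hz : nodeGroup s z.1 = nodeGroup s h <;>
      by_cases hz' : nodeGroup s z'.1 = nodeGroup s h
    · rw [reducedTag_inl_of_eq _ _ hz, reducedTag_inl_of_eq _ _ hz'] at hzz
      have := hlam (Sum.inr.inj hzz)
      rw [Subtype.ext (node_ext (hz.trans hz'.symm) (Prod.mk.inj (Prod.mk.inj this).2).1)]
    · rw [reducedTag_inl_of_eq _ _ hz, reducedTag_inl_of_ne _ _ hz'] at hzz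
      cases hzz
    · rw [reducedTag_inl_of_ne _ _ hz, reducedTag_inl_of_eq _ _ hz'] at hzz
      cases hzz
    · rw [reducedTag_inl_of_ne _ _ hz, reducedTag_inl_of_ne _ _ hz'] at hzz
      have := Prod.mk.inj (Sum.inl.inj hzz)
      rw [Subtype.ext (node_ext (Subtype.mk.inj this.1) this.2)]
  · by_cases hz : nodeGroup s z.1 = nodeGroup s h
    · rw [reducedTag_inl_of_eq _ _ hz, reducedTag_inr] at hzz
      exact (hne _ _ _ hz (Sum.inr.inj hzz)).elim
    · rw [reducedTag_inl_of_ne _ _ hz, reducedTag_inr] at hzz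
      cases hzz
  · by_cases hz : nodeGroup s z'.1 = nodeGroup s h
    · rw [reducedTag_inl_of_eq _ _ hz, reducedTag_inr] at hzz
      exact (hne _ _ _ hz (Sum.inr.inj hzz).symm).elim
    · rw [reducedTag_inl_of_ne _ _ hz, reducedTag_inr] at hzz
      cases hzz
  · rw [reducedTag_inr, reducedTag_inr] at hzz
    rw [(Prod.mk.inj (Prod.mk.inj (hlam (Sum.inr.inj hzz))).2).2]

end reducedTag

section reducedCode

variable {F : Type*} [Field F] {n s : ℕ}

/-- Row `b` of `foldMatrix` is a unit row for every other node of the group, leaving only its digit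
`b`; for `h` it is the full row with signs, involving all `s` parts. Nodes outside the group do not
act on the digit. -/
theorem parityCheck_sum_eq_reducedCheckFirst (lam : Scalars F n s) (r : ℕ) (h : Fin n) (b : Fin s)
    (hb : nodePos s h = b.castSucc) (c : Fin n → SymbolIndex n s → F)
    (x : RestIndex (nodeGroup s h)) (p : Fin r) :
    (∑ j, (parityCheck lam r j).mulVec (c j)) (insertDigit (nodeGroup s h) b x, p) =
      (∑ z, (reducedCheckFirst lam r h b z).mulVec
        (reducedWord h (downloadFirst F (nodeGroup s h) b) c z)) (x, p) := by
  rw [Finset.sum_apply, Finset.sum_apply, Fintype.sum_sum_type,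
    Fintype.sum_eq_add_sum_subtype_ne _ h, add_comm]
  congr 1
  · refine Finset.sum_congr rfl fun z _ => ?_
    by_cases hz : nodeGroup s z.1 ≠ nodeGroup s h
    · simp only [reducedCheckFirst, reducedWord, dif_pos hz, downloadFirst_mulVec]
      exact blockMatrix_mulVec_insertDigit_of_ne r hz _ _ _ _ _ _
    · simp only [reducedCheckFirst, reducedWord, dif_neg hz, downloadFirst_mulVec,
        diagMatrix_mulVec, parityCheck]
      push Not at hz
      have hne : b.castSucc ≠ nodePos s z.1 := fun h' => z.2 (node_ext hz (h'.symm.trans hb.symm))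
      rw [hz, blockMatrix_mulVec_insertDigit_self]
      simp [foldMatrix_of_castSucc_ne hne]
  · rw [parityCheck, blockMatrix_mulVec_insertDigit_self, hb]
    refine Finset.sum_congr rfl fun e _ => ?_
    by_cases he : e = b
    · subst he
      simp [reducedCheckFirst, reducedWord, diagMatrix_mulVec, foldMatrix]
    · simp [reducedCheckFirst, reducedWord, diagMatrix_mulVec, foldMatrix, he, Ne.symm he,
        Matrix.neg_mulVec]

/-- Summing over the digit collapses a node of the group with index `b' < s` to its digit `b'` by
`sum_foldMatrix_castSucc`. For `h` the fold is the identity, so each part keeps its own scalar;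
outside the group the sum moves onto the data. -/
theorem parityCheck_sum_eq_reducedCheckLast (lam : Scalars F n s) (r : ℕ) (h : Fin n)
    (hh : nodePos s h = Fin.last s) (c : Fin n → SymbolIndex n s → F)
    (x : RestIndex (nodeGroup s h)) (p : Fin r) :
    ∑ e : Fin s, (∑ j, (parityCheck lam r j).mulVec (c j)) (insertDigit (nodeGroup s h) e x, p) =
      (∑ z, (reducedCheckLast lam r h z).mulVec
        (reducedWord h (downloadLast F (nodeGroup s h)) c z)) (x, p) := by
  simp only [Finset.sum_apply]
  rw [Finset.sum_comm, Fintype.sum_sum_type, Fintype.sum_eq_add_sum_subtype_ne _ h, add_comm]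
  congr 1
  · refine Finset.sum_congr rfl fun z _ => ?_
    by_cases hz : nodeGroup s z.1 ≠ nodeGroup s h
    · simp only [reducedCheckLast, reducedWord, dif_pos hz, downloadLast_mulVec_of_ne hz]
      have : (fun y => ∑ e, c z.1 (insertDigit (nodeGroup s h) e y)) =
          ∑ e, fun y => c z.1 (insertDigit (nodeGroup s h) e y) := by
        ext y
        simp
      rw [this, Matrix.mulVec_sum, Finset.sum_apply]
      exact Finset.sum_congr rfl fun e _ => blockMatrix_mulVec_insertDigit_of_ne r hz _ _ _ _ _ _
    · simp only [reducedCheckLast, reducedWord, dif_neg hz]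
      push Not at hz
      have hne : nodePos s z.1 ≠ Fin.last s := fun h' => z.2 (node_ext hz (h'.trans hh.symm))
      obtain ⟨b, hb⟩ := Fin.exists_castSucc_eq.2 hne
      have hlt : (nodePos s z.1 : ℕ) < s := by rw [← hb]; exact b.2
      have hbe : (⟨nodePos s z.1, hlt⟩ : Fin s) = b := by
        ext; simp [← hb]
      rw [dif_pos hlt, downloadLast_mulVec_of_eq hz hb, diagMatrix_mulVec, hbe]
      simp only [parityCheck, hz, blockMatrix_mulVec_insertDigit_self]
      rw [Finset.sum_comm]
      simp only [← Finset.sum_mul, ← hb, sum_foldMatrix_castSucc]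
      simp
  · simp only [parityCheck, blockMatrix_mulVec_insertDigit_self, hh]
    refine Finset.sum_congr rfl fun e _ => ?_
    have hne : e.castSucc ≠ Fin.last s := (Fin.castSucc_lt_last e).ne
    simp [foldMatrix_of_castSucc_ne hne, reducedCheckLast, reducedWord, diagMatrix_mulVec]

theorem card_reducedNode (h : Fin n) : Fintype.card (ReducedNode s h) = n + s - 1 := by
  have := h.2
  rw [Fintype.card_sum, Fintype.card_subtype_compl, Fintype.card_fin, Fintype.card_fin,
    Fintype.card_unique]
  omega

theorem card_restIndex_mul (a : Fin (numGroups n s)) :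
    Fintype.card (RestIndex a) * s = s ^ (n ⌈/⌉ (s + 1)) := by
  have := Fintype.card_congr (Equiv.funSplitAt a (Fin s))
  rw [Fintype.card_prod, Fintype.card_fun, Fintype.card_fin, Fintype.card_fin] at this
  rw [mul_comm]
  exact this.symm

theorem Admissible.locallyIndependent {lam : Scalars F n s} (hlam : Admissible lam)
    (a : Fin (numGroups n s)) (B : Finset (Fin (s + 1))) :
    LocallyIndependent (fun b e => lam (a, b, e)) B :=
  (localMatrix_det_ne_zero_iff lam a B).1 (hlam.2 a B)

theorem Admissible.isMDSArrayCode_secondCode {lam : Scalars F n s} (hlam : Admissible lam)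
    {k : ℕ} (hk : k ≤ n) : IsMDSArrayCode (secondCode lam (n - k)) k := by
  refine isMDSArrayCode_taggedCheck (k := k) (by rw [Fintype.card_fin]; omega)
    (fun a b e => lam (a, b, e)) (hlam.locallyIndependent) ?_
    (fun j => Sum.inl (nodeGroup s j, nodePos s j)) ?_ ?_ (fun _ => 1) (fun _ => one_ne_zero)
  · intro a a' b b' e e' h
    exact congrArg Prod.fst (hlam.1 h)
  · intro j j' h
    simp only [Sum.inl.injEq, Prod.mk.injEq] at h
    exact node_ext h.1 h.2
  · intro z x h
    simp at h

/-- Common source of both reduced codes; the choice of digits goes into `f` and the signs into `ε`.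
Block nodes use only positions outside the group of `h`, so their scalars avoid those of the scalar
nodes. -/
theorem Admissible.isMDSArrayCode_reducedTag {lam : Scalars F n s} (hlam : Admissible lam)
    (hs : 0 < s) {k : ℕ} (hk : k ≤ n) (h : Fin n) (f : {j : Fin n // j ≠ h} → Fin s)
    (ε : ReducedNode s h → F) (hε : ∀ z, ε z ≠ 0) :
    IsMDSArrayCode (arrayCode fun z => taggedCheck (n - k)
      (fun (a : {u // u ≠ nodeGroup s h}) b e => lam (a.1, b, e)) (ε z) (reducedTag lam h f z))
      (k + s - 1) := by
  have hcard : k + s - 1 + (n - k) = Fintype.card (ReducedNode s h) := by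
    have := h.2
    rw [card_reducedNode]
    omega
  refine isMDSArrayCode_taggedCheck hcard
    (fun (a : {u // u ≠ nodeGroup s h}) b e => lam (a.1, b, e))
    (fun a B => hlam.locallyIndependent a.1 B) ?_
    (reducedTag lam h f) (reducedTag_injective hlam.1 h f) ?_ ε hε
  · intro a a' b b' e e' h
    exact Subtype.ext (congrArg Prod.fst (hlam.1 h))
  · rintro (z | e) x hx a b' e' hax
    · by_cases hz : nodeGroup s z.1 = nodeGroup s h
      · rw [reducedTag_inl_of_eq _ _ hz] at hx
        exact a.2 (congrArg Prod.fst (hlam.1 (hax.trans (Sum.inr.inj hx).symm)))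
      · rw [reducedTag_inl_of_ne _ _ hz] at hx
        cases hx
    · exact a.2 (congrArg Prod.fst (hlam.1 (hax.trans (Sum.inr.inj hx).symm)))

theorem Admissible.isMDSArrayCode_reducedCheckFirst {lam : Scalars F n s} (hlam : Admissible lam)
    {k : ℕ} (hk : k ≤ n) (h : Fin n) (b : Fin s) (hb : nodePos s h = b.castSucc) :
    IsMDSArrayCode (arrayCode (reducedCheckFirst lam (n - k) h b)) (k + s - 1) := by
  have key := hlam.isMDSArrayCode_reducedTag b.pos hk h (fun _ => b)
    (Sum.elim (fun _ => 1) (fun e => if e = b then 1 else -1)) (by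
      rintro (z | e)
      · exact one_ne_zero
      · simp only [Sum.elim_inr]
        split_ifs <;> simp)
  convert key using 2
  funext z
  rcases z with z | e
  · by_cases hz : nodeGroup s z.1 = nodeGroup s h
    · rw [reducedTag_inl_of_eq _ _ hz, reducedCheckFirst, dif_neg (not_not.2 hz), taggedCheck,
        Sum.elim_inl, one_smul]
    · rw [reducedTag_inl_of_ne _ _ hz, reducedCheckFirst, dif_pos hz, taggedCheck]
  · rw [reducedTag_inr, reducedCheckFirst, taggedCheck, Sum.elim_inr, hb]
    split_ifs
    · rw [one_smul]
    · rw [neg_one_smul]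

theorem Admissible.isMDSArrayCode_reducedCheckLast {lam : Scalars F n s} (hlam : Admissible lam)
    (hs : 0 < s) {k : ℕ} (hk : k ≤ n) (h : Fin n) (hh : nodePos s h = Fin.last s) :
    IsMDSArrayCode (arrayCode (reducedCheckLast lam (n - k) h)) (k + s - 1) := by
  have key := hlam.isMDSArrayCode_reducedTag hs hk h
    -- The default digit is immaterial: `reducedTag` consults `f` only inside the group of `h`,
    -- where every other node has index below `s`.
    (fun z => if hz : (nodePos s z.1 : ℕ) < s then ⟨nodePos s z.1, hz⟩ else ⟨0, hs⟩)
    (fun _ => 1) (fun _ => one_ne_zero)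
  convert key using 2
  funext z
  rcases z with z | e
  · by_cases hz : nodeGroup s z.1 = nodeGroup s h
    · have hlt : (nodePos s z.1 : ℕ) < s :=
        Fin.val_lt_last fun h' => z.2 (node_ext hz (h'.trans hh.symm))
      rw [reducedTag_inl_of_eq _ _ hz, reducedCheckLast, dif_neg (not_not.2 hz), dif_pos hlt,
        dif_pos hlt, taggedCheck, one_smul]
    · rw [reducedTag_inl_of_ne _ _ hz, reducedCheckLast, dif_pos hz, taggedCheck]
  · rw [reducedTag_inr, reducedCheckLast, taggedCheck, one_smul, hh]

end reducedCode

/-! ### Linear repair from downloaded data -/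

section repair

variable {F ν ι : Type*} [Field F] [Fintype ι]

/-- A node is repaired linearly as soon as the downloaded data determine it. -/
theorem repairs_of_forall_eq_zero (C : Submodule F (ν → ι → F)) (h : ν) (𝓗 : Finset ν)
    {β : ν → Type*} (D : ∀ j, Matrix (β j) ι F)
    (H : ∀ c ∈ C, (∀ j ∈ 𝓗, (D j).mulVec (c j) = 0) → c h = 0) : Repairs C h 𝓗 D := by
  let φ : C →ₗ[F] (∀ j : 𝓗, β j → F) :=
    (LinearMap.pi fun j : 𝓗 => (D j).mulVecLin ∘ₗ LinearMap.proj j.1) ∘ₗ C.subtype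
  let ψ : C →ₗ[F] (ι → F) := LinearMap.proj h ∘ₗ C.subtype
  have hker : LinearMap.ker φ ≤ LinearMap.ker ψ := by
    intro c hc
    exact H c c.2 fun j hj => congrFun (LinearMap.mem_ker.1 hc) ⟨j, hj⟩
  -- The map to node `h` factors through the range of the download map; it is then extended linearly
  -- to all data.
  obtain ⟨g, hg⟩ := LinearMap.exists_extend
    ((LinearMap.ker φ).liftQ ψ hker ∘ₗ φ.quotKerEquivRange.symm.toLinearMap)
  refine ⟨g, fun c hc => ?_⟩
  have h1 := LinearMap.congr_fun hg ⟨φ ⟨c, hc⟩, LinearMap.mem_range_self φ _⟩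
  have h2 : φ.quotKerEquivRange.symm ⟨φ ⟨c, hc⟩, LinearMap.mem_range_self φ _⟩ =
      (LinearMap.ker φ).mkQ ⟨c, hc⟩ := by
    rw [LinearEquiv.symm_apply_eq]
    rfl
  refine h1.trans ?_
  rw [LinearMap.comp_apply, LinearEquiv.coe_coe, h2]
  rfl

/-- Needed because `IsMSRCode` indexes downloads by `Fin`. -/
theorem Repairs.reindex {C : Submodule F (ν → ι → F)} {h : ν} {𝓗 : Finset ν}
    {β β' : ν → Type*} {D : ∀ j, Matrix (β j) ι F} (hD : Repairs C h 𝓗 D)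
    (e : ∀ j, β j ≃ β' j) : Repairs C h 𝓗 fun j => (D j).submatrix (e j).symm id := by
  obtain ⟨g, hg⟩ := hD
  refine repairs_of_forall_eq_zero C h 𝓗 _ fun c hc h0 => ?_
  have : (fun j : 𝓗 => (D j).mulVec (c j)) = 0 := by
    funext j x
    have := congrFun (h0 j j.2) (e j x)
    simpa [Matrix.mulVec, Matrix.submatrix] using this
  rw [← hg c hc, this, map_zero]

end repair

theorem repairBandwidth_restIndex {F : Type*} {n s : ℕ} (a : Fin (numGroups n s)) (𝓗 : Finset (Fin n))
    (D : Fin n → Matrix (RestIndex a) (SymbolIndex n s) F) :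
    repairBandwidth 𝓗 D = 𝓗.card * Fintype.card (RestIndex a) := by
  simp only [repairBandwidth, Finset.sum_const, smul_eq_mul]

/-! ### The two repair schemes: bandwidth and access -/

section repairSchemes

variable {F : Type*} [Field F] {n s : ℕ}

/-- If the reduced words of the codewords lie in an MDS code of dimension `d`, any `d` helper
nodes repair node `h`. -/
theorem repairs_of_reducedWord_mem (C : Submodule F (Fin n → SymbolIndex n s → F)) (h : Fin n)
    (D : Fin n → Matrix (RestIndex (nodeGroup s h)) (SymbolIndex n s) F)
    (C' : Submodule F (ReducedNode s h → RestIndex (nodeGroup s h) → F)) {d : ℕ}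
    (hC' : IsMDSArrayCode C' d) (hmem : ∀ c ∈ C, reducedWord h D c ∈ C')
    (𝓗 : Finset (Fin n)) (hh : h ∉ 𝓗) (hd : 𝓗.card = d) : Repairs C h 𝓗 D := by
  classical
  refine repairs_of_forall_eq_zero C h 𝓗 D fun c hc h0 => ?_
  let T : Finset (ReducedNode s h) :=
    𝓗.attach.map ⟨fun j => Sum.inl ⟨j.1, fun h' => hh (h' ▸ j.2)⟩, by
      intro j j' hjj
      exact Subtype.ext (Subtype.mk.inj (Sum.inl.inj hjj))⟩
  have hT : T.card = d := by simp [T, hd]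
  have := hC'.2 T hT _ (hmem c hc) 0 C'.zero_mem (by
    intro z hz
    simp only [T, Finset.mem_map, Finset.mem_attach, true_and] at hz
    obtain ⟨j, rfl⟩ := hz
    exact h0 j j.2)
  ext i
  have h1 := congrFun (congrFun this (Sum.inr (i (nodeGroup s h)))) fun u => i u
  simp only [reducedWord, insertDigit_eta] at h1
  exact h1

theorem card_restIndex_eq_div (hs : 0 < s) (a : Fin (numGroups n s)) :
    (Fintype.card (RestIndex a) : ℚ) = (s ^ (n ⌈/⌉ (s + 1)) : ℕ) / s := by
  have : (s : ℚ) ≠ 0 := by positivity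
  rw [← card_restIndex_mul a, eq_div_iff this]
  push_cast
  rfl

theorem mul_card_restIndex_eq_cutSetBound (hs : 0 < s) {k d : ℕ} (hd : d + 1 = k + s)
    (a : Fin (numGroups n s)) :
    ((d * Fintype.card (RestIndex a) : ℕ) : ℚ) = cutSetBound k d (s ^ (n ⌈/⌉ (s + 1))) := by
  have h : (d : ℚ) - k + 1 = s := by
    have : (d : ℚ) + 1 = k + s := by exact_mod_cast hd
    linarith
  rw [cutSetBound, h, Nat.cast_mul, card_restIndex_eq_div hs, mul_div_assoc]

theorem ncard_range_insertDigit (a : Fin (numGroups n s)) (b : Fin s) :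
    (Set.range (insertDigit a b)).ncard = Fintype.card (RestIndex a) := by
  rw [Set.ncard_range_of_injective fun x x' hx => (insertDigit_inj.1 hx).2,
    Nat.card_eq_fintype_card]

theorem accessedSymbols_downloadFirst (a : Fin (numGroups n s)) (b : Fin s) (j : Fin n) :
    accessedSymbols (downloadFirst F a b j) = Set.range (insertDigit a b) := by
  ext i
  simp [accessedSymbols, downloadFirst, eq_comm]

theorem accessedSymbols_downloadLast_of_ne {a : Fin (numGroups n s)} {j : Fin n}
    (hj : nodeGroup s j ≠ a) : accessedSymbols (downloadLast F a j) = Set.univ := by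
  refine Set.eq_univ_of_forall fun i => ⟨fun u => i u, ?_⟩
  rw [downloadLast_of_ne hj, if_pos ⟨i a, (insertDigit_eta i).symm⟩]
  exact one_ne_zero

theorem accessedSymbols_downloadLast_of_eq {a : Fin (numGroups n s)} {j : Fin n}
    (hj : nodeGroup s j = a) {b : Fin s} (hb : b.castSucc = nodePos s j) :
    accessedSymbols (downloadLast F a j) = Set.range (insertDigit a b) := by
  ext i
  simp only [accessedSymbols, downloadLast, Set.mem_ofPred_eq, ne_eq, ite_eq_right_iff, one_ne_zero,
    imp_false, not_not, Set.mem_range]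
  constructor
  · rintro ⟨x, e, he, rfl⟩
    rw [← Fin.castSucc_injective _ ((he hj).trans hb.symm)]
    exact ⟨x, rfl⟩
  · rintro ⟨x, rfl⟩
    exact ⟨x, b, fun _ => hb, rfl⟩

variable {lam : Scalars F n s} {k d : ℕ}

theorem Admissible.repairs_downloadFirst (hlam : Admissible lam) (hk : k ≤ n)
    (hd : d + 1 = k + s) (h : Fin n) (b : Fin s) (hb : nodePos s h = b.castSucc)
    (𝓗 : Finset (Fin n)) (hh : h ∉ 𝓗) (h𝓗 : 𝓗.card = d) :
    Repairs (secondCode lam (n - k)) h 𝓗 (downloadFirst F (nodeGroup s h) b) := by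
  refine repairs_of_reducedWord_mem _ h _ _
    (hlam.isMDSArrayCode_reducedCheckFirst hk h b hb) ?_ 𝓗 hh (by omega)
  intro c hc
  change ∑ z, _ = _
  ext ⟨x, p⟩
  rw [← parityCheck_sum_eq_reducedCheckFirst lam (n - k) h b hb c x p,
    show ∑ j, (parityCheck lam (n - k) j).mulVec (c j) = 0 from hc]
  rfl

theorem Admissible.repairs_downloadLast (hlam : Admissible lam) (hs : 0 < s) (hk : k ≤ n)
    (hd : d + 1 = k + s) (h : Fin n) (hl : nodePos s h = Fin.last s)
    (𝓗 : Finset (Fin n)) (hh : h ∉ 𝓗) (h𝓗 : 𝓗.card = d) :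
    Repairs (secondCode lam (n - k)) h 𝓗 (downloadLast F (nodeGroup s h)) := by
  refine repairs_of_reducedWord_mem _ h _ _
    (hlam.isMDSArrayCode_reducedCheckLast hs hk h hl) ?_ 𝓗 hh (by omega)
  intro c hc
  change ∑ z, _ = _
  ext ⟨x, p⟩
  rw [← parityCheck_sum_eq_reducedCheckLast lam (n - k) h hl c x p,
    show ∑ j, (parityCheck lam (n - k) j).mulVec (c j) = 0 from hc]
  simp

theorem repairAccess_downloadFirst (a : Fin (numGroups n s)) (b : Fin s) (𝓗 : Finset (Fin n)) :
    repairAccess 𝓗 (downloadFirst F a b) = 𝓗.card * Fintype.card (RestIndex a) := by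
  simp only [repairAccess, accessedSymbols_downloadFirst, ncard_range_insertDigit,
    Finset.sum_const, smul_eq_mul]

/-- A helper in the group reads `ℓ / s` symbols, one outside reads all `ℓ`, and `ℓ / s < ℓ` because
`s ≥ 2`. -/
theorem lt_repairAccess_downloadLast (hs : 2 ≤ s) (h : Fin n) (hl : nodePos s h = Fin.last s)
    (𝓗 : Finset (Fin n)) (hh : h ∉ 𝓗) (hout : ∃ j ∈ 𝓗, nodeGroup s j ≠ nodeGroup s h) :
    𝓗.card * Fintype.card (RestIndex (nodeGroup s h)) <
      repairAccess 𝓗 (downloadLast F (nodeGroup s h)) := by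
  have hcard := card_restIndex_mul (nodeGroup s h)
  have : NeZero s := ⟨by omega⟩
  have hpos : 0 < Fintype.card (RestIndex (nodeGroup s h)) := Fintype.card_pos
  have hlt : ∀ j, nodeGroup s j ≠ nodeGroup s h → Fintype.card (RestIndex (nodeGroup s h)) <
      (accessedSymbols (downloadLast F (nodeGroup s h) j)).ncard := by
    intro j hj
    have hsym : Fintype.card (SymbolIndex n s) = s ^ (n ⌈/⌉ (s + 1)) := by
      rw [Fintype.card_fun, Fintype.card_fin, Fintype.card_fin, numGroups]
    rw [accessedSymbols_downloadLast_of_ne hj, Set.ncard_univ, Nat.card_eq_fintype_card, hsym,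
      ← hcard]
    nlinarith
  rw [repairAccess, ← smul_eq_mul, ← Finset.sum_const]
  obtain ⟨j₀, hj₀, hne⟩ := hout
  refine Finset.sum_lt_sum (fun j hj => ?_) ⟨j₀, hj₀, hlt j₀ hne⟩
  by_cases hg : nodeGroup s j = nodeGroup s h
  · have hp : nodePos s j ≠ Fin.last s := fun h' =>
      hh (node_ext hg (h'.trans hl.symm) ▸ hj)
    obtain ⟨b, hb⟩ := Fin.exists_castSucc_eq.2 hp
    rw [accessedSymbols_downloadLast_of_eq hg hb, ncard_range_insertDigit]
  · exact (hlt j hg).le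

theorem Admissible.isMSRCode_secondCode (hlam : Admissible lam) (hs : 0 < s) (hk : k ≤ n)
    (hd : d + 1 = k + s) : IsMSRCode (secondCode lam (n - k)) k d (s ^ (n ⌈/⌉ (s + 1))) := by
  refine ⟨by rw [Fintype.card_fun, Fintype.card_fin, Fintype.card_fin, numGroups],
    hlam.isMDSArrayCode_secondCode hk, fun h 𝓗 hh h𝓗 => ?_⟩
  have key : ∃ D : Fin n → Matrix (RestIndex (nodeGroup s h)) (SymbolIndex n s) F,
      Repairs (secondCode lam (n - k)) h 𝓗 D := by
    by_cases hl : nodePos s h = Fin.last s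
    · exact ⟨_, hlam.repairs_downloadLast hs hk hd h hl 𝓗 hh h𝓗⟩
    · obtain ⟨b, hb⟩ := Fin.exists_castSucc_eq.2 hl
      exact ⟨_, hlam.repairs_downloadFirst hk hd h b hb.symm 𝓗 hh h𝓗⟩
  obtain ⟨D, hD⟩ := key
  refine ⟨fun _ => Fintype.card (RestIndex (nodeGroup s h)), _,
    hD.reindex fun _ => Fintype.equivFin _, ?_⟩
  rw [← mul_card_restIndex_eq_cutSetBound hs hd (nodeGroup s h), ← h𝓗]
  simp [repairBandwidth]

end repairSchemes

/-! ### The local constraints as polynomial conditions -/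

section singleDigit

variable {s : ℕ}

/-- The single-digit version of the local constraint matrix. -/
def singleDigitMatrix {R : Type*} [CommRing R] (μ : Fin (s + 1) × Fin s → R)
    (B : Finset (Fin (s + 1))) : Matrix (Fin s × Fin B.card) (Fin s × Fin B.card) R :=
  fun ip eq => foldMatrix R (B.orderEmbOfFin rfl eq.2) ip.1 eq.1 *
    μ (B.orderEmbOfFin rfl eq.2, eq.1) ^ (ip.2 : ℕ)

theorem map_singleDigitMatrix_det {R R' : Type*} [CommRing R] [CommRing R'] (f : R →+* R')
    (μ : Fin (s + 1) × Fin s → R) (B : Finset (Fin (s + 1))) :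
    f (singleDigitMatrix μ B).det = (singleDigitMatrix (fun x => f (μ x)) B).det := by
  rw [RingHom.map_det]
  congr 1
  ext ip eq
  simp only [RingHom.mapMatrix_apply, Matrix.map_apply, singleDigitMatrix, foldMatrix, map_mul,
    map_pow]
  congr 1
  split_ifs <;> simp

theorem singleDigitMatrix_mulVec {F : Type*} [Field F] (μ : Fin (s + 1) × Fin s → F)
    (B : Finset (Fin (s + 1))) (w : Fin (s + 1) → Fin s → F) (i : Fin s) (p : Fin B.card) :
    (singleDigitMatrix μ B).mulVec (fun eq => w (B.orderEmbOfFin rfl eq.2) eq.1) (i, p) =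
      (∑ b ∈ B, (foldMatrix F b).mulVec (fun e => μ (b, e) ^ (p : ℕ) * w b e)) i := by
  rw [Finset.sum_apply, ← sum_orderEmbOfFin, Matrix.mulVec, dotProduct,
    Fintype.sum_prod_type_right]
  simp only [singleDigitMatrix, Matrix.mulVec, dotProduct, mul_assoc]

theorem singleDigitMatrix_det_ne_zero_iff {F : Type*} [Field F] (μ : Fin (s + 1) × Fin s → F)
    (B : Finset (Fin (s + 1))) :
    (singleDigitMatrix μ B).det ≠ 0 ↔ LocallyIndependent (fun b e => μ (b, e)) B := by
  rw [Ne, ← Matrix.exists_mulVec_eq_zero_iff]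
  push Not
  constructor
  · intro h w hw b hb
    by_contra hne
    obtain ⟨q, hq⟩ := exists_orderEmbOfFin_eq B hb
    refine h (fun eq => w (B.orderEmbOfFin rfl eq.2) eq.1) (fun h0 => hne ?_) ?_
    · ext e
      have := congrFun h0 (e, q)
      simpa [hq] using this
    · ext ⟨i, p⟩
      rw [singleDigitMatrix_mulVec, hw p p.2]
      rfl
  · intro h v hv hv0
    obtain ⟨w, rfl⟩ := eq_comp_orderEmbOfFin B v
    refine hv ?_
    have := h w (by
      intro p hp
      ext i
      rw [← singleDigitMatrix_mulVec μ B w i ⟨p, hp⟩, hv0]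
      rfl)
    ext ⟨j, q⟩
    simp [this _ (B.orderEmbOfFin_mem rfl q)]

/-- All rows but the one indexed by `b` are unit rows; once those coordinates vanish, the remaining
row gives the last one. -/
theorem eq_zero_of_foldMatrix_mulVec_eq_zero {F : Type*} [Field F] (b : Fin (s + 1))
    (w : Fin s → F) (h : (foldMatrix F b).mulVec w = 0) : w = 0 := by
  have h1 : ∀ i : Fin s, i.castSucc ≠ b → w i = 0 := by
    intro i hi
    have := congrFun h i
    simpa [Matrix.mulVec, dotProduct, foldMatrix, hi] using this
  ext i
  by_cases hi : i.castSucc = b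
  · have := congrFun h i
    rw [Matrix.mulVec, dotProduct, Finset.sum_eq_single i] at this
    · simpa [foldMatrix] using this
    · intro e _ he
      rw [h1 e, mul_zero]
      exact fun h' => he (Fin.castSucc_injective _ (h'.trans hi.symm))
    · simp
  · exact h1 i hi

/-- Scalars that depend only on the in-group index satisfy the local constraints. -/
theorem locallyIndependent_of_injective {F : Type*} [Field F] {x : Fin (s + 1) → F}
    (hx : Function.Injective x) (B : Finset (Fin (s + 1))) :
    LocallyIndependent (fun b _ => x b) B := by
  intro w hw b hb
  refine eq_zero_of_foldMatrix_mulVec_eq_zero b _ (funext fun i => ?_)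
  obtain ⟨q, rfl⟩ := exists_orderEmbOfFin_eq B hb
  -- The powers of `x b` pull out of the fold, so each coordinate `i` satisfies an ordinary
  -- Vandermonde system.
  refine congrFun (Matrix.eq_zero_of_forall_pow_sum_mul_pow_eq_zero
    (f := fun q => x (B.orderEmbOfFin rfl q))
    (v := fun q => (foldMatrix F (B.orderEmbOfFin rfl q)).mulVec (w (B.orderEmbOfFin rfl q)) i)
    (hx.comp (B.orderEmbOfFin rfl).injective) fun p => ?_) q
  have h := congrFun (hw p p.2) i
  rw [Finset.sum_apply, ← sum_orderEmbOfFin] at h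
  rw [← Pi.zero_apply (M := fun _ => F) i, ← h]
  refine Finset.sum_congr rfl fun q _ => ?_
  have : (fun e => x (B.orderEmbOfFin rfl q) ^ (p : ℕ) * w (B.orderEmbOfFin rfl q) e) =
      x (B.orderEmbOfFin rfl q) ^ (p : ℕ) • w (B.orderEmbOfFin rfl q) := rfl
  rw [this, Matrix.mulVec_smul, Pi.smul_apply, smul_eq_mul, mul_comm]

/-- The determinant of the single-digit matrix as a polynomial in its scalars. -/
noncomputable def localPolynomial (F : Type*) [Field F] (B : Finset (Fin (s + 1))) :
    MvPolynomial (Fin (s + 1) × Fin s) F :=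
  (singleDigitMatrix MvPolynomial.X B).det

theorem eval_localPolynomial {F : Type*} [Field F] (μ : Fin (s + 1) × Fin s → F)
    (B : Finset (Fin (s + 1))) :
    MvPolynomial.eval μ (localPolynomial F B) = (singleDigitMatrix μ B).det := by
  rw [localPolynomial, map_singleDigitMatrix_det]
  simp

/-- Entries in a row `(i, p)` have degree at most `p`, so each Leibniz term has degree at most `s`
times the sum of all `p < B.card`. -/
theorem totalDegree_localPolynomial_le {F : Type*} [Field F] (B : Finset (Fin (s + 1))) :
    (localPolynomial F B).totalDegree ≤ s * (B.card * (B.card - 1) / 2) := by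
  rw [localPolynomial, Matrix.det_apply]
  refine MvPolynomial.totalDegree_finsetSum_le fun σ _ => ?_
  have hprod : (∏ i, singleDigitMatrix (MvPolynomial.X (R := F)) B (σ i) i).totalDegree ≤
      s * (B.card * (B.card - 1) / 2) := by
    refine (MvPolynomial.totalDegree_finsetProd _ _).trans ?_
    have h1 : ∀ i, (singleDigitMatrix (MvPolynomial.X (R := F)) B (σ i) i).totalDegree ≤
        ((σ i).2 : ℕ) := by
      intro i
      refine (MvPolynomial.totalDegree_mul _ _).trans ?_
      have e1 : (foldMatrix (MvPolynomial (Fin (s + 1) × Fin s) F) (B.orderEmbOfFin rfl i.2)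
          (σ i).1 i.1).totalDegree = 0 := by
        simp only [foldMatrix]
        split_ifs <;> simp
      rw [e1, zero_add, MvPolynomial.totalDegree_X_pow]
    refine (Finset.sum_le_sum fun i _ => h1 i).trans ?_
    rw [Equiv.sum_comp σ (fun ip : Fin s × Fin B.card => (ip.2 : ℕ)), Fintype.sum_prod_type]
    simp only [Finset.sum_const, Finset.card_univ, Fintype.card_fin, smul_eq_mul]
    rw [Fin.sum_univ_eq_sum_range (fun p => p), Finset.sum_range_id]
  rcases Int.units_eq_one_or (Equiv.Perm.sign σ) with h | h
  · rwa [h, one_smul]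
  · rwa [h, Units.neg_smul, one_smul, MvPolynomial.totalDegree_neg]

theorem sum_totalDegree_localPolynomial_le (F : Type*) [Field F] :
    ∑ B : Finset (Fin (s + 1)), (localPolynomial F B).totalDegree ≤
      ∑ t ∈ Finset.Icc 1 (s + 1), (s + 1).choose t * (s * (t * (t - 1) / 2)) := by
  refine (Finset.sum_le_sum fun B _ => totalDegree_localPolynomial_le B).trans ?_
  rw [← Finset.powerset_univ, Finset.sum_powerset_apply_card
    (fun t => s * (t * (t - 1) / 2)), Finset.card_univ,
    Fintype.card_fin, Finset.range_eq_Ico, Finset.sum_eq_sum_Ico_succ_bot (by omega)]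
  simp only [smul_eq_mul, zero_mul, Nat.zero_div, mul_zero, zero_add]
  rfl

end singleDigit

/-! ### Distinctness as a polynomial condition -/

/-- The product of the differences of the variables. -/
noncomputable def differenceProduct (F σ : Type*) [Field F] [Fintype σ] : MvPolynomial σ F :=
  ∏ pq : σ × σ with Fintype.equivFin σ pq.1 < Fintype.equivFin σ pq.2,
    (MvPolynomial.X pq.1 - MvPolynomial.X pq.2)

section differenceProduct

variable {F σ : Type*} [Field F] [Fintype σ]

theorem differenceProduct_ne_zero : differenceProduct F σ ≠ 0 := by
  refine Finset.prod_ne_zero_iff.2 fun pq hpq => sub_ne_zero.2 fun h => ?_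
  have := MvPolynomial.X_injective h
  simp [this] at hpq

theorem injective_of_eval_differenceProduct_ne_zero {μ : σ → F}
    (h : MvPolynomial.eval μ (differenceProduct F σ) ≠ 0) : Function.Injective μ := by
  rw [differenceProduct, map_prod, Finset.prod_ne_zero_iff] at h
  intro p q hpq
  by_contra hne
  rcases lt_or_gt_of_ne fun h' => hne ((Fintype.equivFin σ).injective h') with hlt | hlt
  · exact h (p, q) (by simpa using hlt) (by simp [hpq])
  · exact h (q, p) (by simpa using hlt) (by simp [hpq])

theorem degreeOf_differenceProduct_lt (i : σ) :
    (differenceProduct F σ).degreeOf i < Fintype.card σ := by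
  classical
  refine (MvPolynomial.degreeOf_prod_le i _ _).trans_lt ?_
  have h1 : ∀ pq : σ × σ, (MvPolynomial.X (R := F) pq.1 - MvPolynomial.X pq.2).degreeOf i ≤
      if pq.1 = i ∨ pq.2 = i then 1 else 0 := by
    intro pq
    refine (MvPolynomial.degreeOf_sub_le i _ _).trans ?_
    rw [MvPolynomial.degreeOf_X, MvPolynomial.degreeOf_X]
    grind
  refine (Finset.sum_le_sum fun pq _ => h1 pq).trans_lt ?_
  rw [Finset.sum_boole, Nat.cast_id]
  refine lt_of_le_of_lt (b := (Finset.univ.erase i).card) ?_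
    (Finset.card_erase_lt_of_mem (Finset.mem_univ i))
  -- A factor containing variable `i` is sent to its other variable; this is injective since each
  -- unordered pair occurs in one order only.
  refine Finset.card_le_card_of_injOn (fun pq => if pq.1 = i then pq.2 else pq.1) ?_ ?_
  · rintro ⟨p, q⟩ hpq
    simp only [Finset.coe_filter, Finset.mem_filter, Finset.mem_univ, true_and] at hpq
    obtain ⟨hlt, rfl | rfl⟩ := hpq
    · simpa using fun h : q = p => by simp [h] at hlt
    · have : p ≠ q := fun h => by simp [h] at hlt
      simp [this]
  · rintro ⟨p, q⟩ hpq ⟨p', q'⟩ hpq' heq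
    simp only [Finset.coe_filter, Finset.mem_filter, Finset.mem_univ, true_and,
      Set.mem_ofPred_eq] at hpq hpq'
    have ne : p ≠ q := fun h => by simp [h] at hpq
    have ne' : p' ≠ q' := fun h => by simp [h] at hpq'
    simp only at heq
    obtain ⟨hlt, rfl | rfl⟩ := hpq <;> obtain ⟨hlt', rfl | rfl⟩ := hpq'
    · simpa using heq
    · simp only [if_true, if_neg ne'] at heq
      subst heq
      exact absurd hlt (lt_asymm hlt')
    · simp only [if_true, if_neg ne] at heq
      subst heq
      exact absurd hlt (lt_asymm hlt')
    · simpa [ne, ne'] using heq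

end differenceProduct

/-! ### Existence of admissible scalars -/

section existence

variable {F : Type*} [Field F] {s : ℕ}

/-- A large set of scalars contains admissible scalars for one group. -/
theorem exists_groupScalars (S : Finset F)
    (hS : (s + 1) * s + ∑ t ∈ Finset.Icc 1 (s + 1), (s + 1).choose t * (s * (t * (t - 1) / 2)) ≤
      S.card) (hs : 0 < s) :
    ∃ μ : Fin (s + 1) × Fin s → F, Function.Injective μ ∧ (∀ x, μ x ∈ S) ∧
      ∀ B, LocallyIndependent (fun b e => μ (b, e)) B := by
  have hcard : Fintype.card (Fin (s + 1)) ≤ S.card := by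
    rw [Fintype.card_fin]
    exact (Nat.le_mul_of_pos_right _ hs).trans ((Nat.le_add_right _ _).trans hS)
  -- Scalars constant in the digit serve only to show that the local polynomials are nonzero; they
  -- are not themselves admissible when `s > 1`.
  obtain ⟨x, -, hx⟩ : ∃ x : Fin (s + 1) → F, (∀ b, x b ∈ S) ∧ Function.Injective x := by
    rw [← Fintype.card_coe S] at hcard
    obtain ⟨f⟩ := Function.Embedding.nonempty_of_card_le hcard
    exact ⟨fun b => f b, fun b => (f b).2, Subtype.val_injective.comp f.injective⟩
  let P := (∏ B : Finset (Fin (s + 1)), localPolynomial F B) *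
    differenceProduct F (Fin (s + 1) × Fin s)
  have hP : P ≠ 0 := by
    refine mul_ne_zero (Finset.prod_ne_zero_iff.2 fun B _ h0 => ?_) differenceProduct_ne_zero
    have := (singleDigitMatrix_det_ne_zero_iff (fun be => x be.1) B).2
      (locallyIndependent_of_injective hx B)
    rw [← eval_localPolynomial, h0, map_zero] at this
    exact this rfl
  have hdeg : ∀ i, P.degreeOf i < S.card := by
    intro i
    refine lt_of_lt_of_le ((MvPolynomial.degreeOf_mul_le i _ _).trans_lt ?_) hS
    rw [add_comm]
    have h1 := degreeOf_differenceProduct_lt (F := F) i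
    rw [Fintype.card_prod, Fintype.card_fin, Fintype.card_fin] at h1
    refine add_lt_add_of_lt_of_le h1 ?_
    refine (MvPolynomial.degreeOf_prod_le i _ _).trans ?_
    exact (Finset.sum_le_sum fun B _ => MvPolynomial.degreeOf_le_totalDegree _ i).trans
      (sum_totalDegree_localPolynomial_le F)
  obtain ⟨μ, hμS, hμ⟩ : ∃ μ : Fin (s + 1) × Fin s → F, (∀ i, μ i ∈ S) ∧
      MvPolynomial.eval μ P ≠ 0 := by
    by_contra hcon
    push Not at hcon
    exact hP (MvPolynomial.eq_zero_of_eval_zero_at_prod_finset P (fun _ => S) hdeg hcon)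
  rw [map_mul, map_prod] at hμ
  refine ⟨μ, injective_of_eval_differenceProduct_ne_zero (right_ne_zero_of_mul hμ), hμS,
    fun B => ?_⟩
  rw [← singleDigitMatrix_det_ne_zero_iff, ← eval_localPolynomial]
  exact Finset.prod_ne_zero_iff.1 (left_ne_zero_of_mul hμ) B (Finset.mem_univ B)

/-- Different groups interact only through distinctness, so groups are chosen greedily: after `m`
groups at most `m (s + 1) s` elements are used, and the complement still meets the bound for one
group. -/
theorem exists_scalars_of_groups [Fintype F] (hs : 0 < s) (m : ℕ)
    (hm : (s + 1) * m * s +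
      ∑ t ∈ Finset.Icc 1 (s + 1), (s + 1).choose t * (s * (t * (t - 1) / 2)) ≤ Fintype.card F) :
    ∃ lam : ℕ → Fin (s + 1) × Fin s → F,
      (∀ a < m, ∀ a' < m, ∀ x x', lam a x = lam a' x' → a = a' ∧ x = x') ∧
      ∀ a < m, ∀ B, LocallyIndependent (fun b e => lam a (b, e)) B := by
  classical
  induction m with
  | zero => exact ⟨fun _ _ => 0, by simp, by simp⟩
  | succ m ih =>
    obtain ⟨lam, hinj, hloc⟩ := ih (le_trans (by gcongr; omega) hm)
    let U : Finset F := Finset.univ.image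
      (fun ax : Fin m × (Fin (s + 1) × Fin s) => lam ax.1 ax.2)
    have hU : U.card ≤ m * ((s + 1) * s) := by
      refine Finset.card_image_le.trans ?_
      simp
    obtain ⟨μ, hμ, hμS, hμl⟩ := exists_groupScalars (s := s) Uᶜ (by
      rw [Finset.card_compl]
      have : (s + 1) * (m + 1) * s = m * ((s + 1) * s) + (s + 1) * s := by ring
      omega) hs
    have hnot : ∀ a < m, ∀ x x', lam a x ≠ μ x' := by
      intro a ha x x' h
      refine Finset.mem_compl.1 (hμS x') ?_
      exact Finset.mem_image.2 ⟨(⟨a, ha⟩, x), Finset.mem_univ _, h⟩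
    refine ⟨Function.update lam m μ, ?_, ?_⟩
    · intro a ha a' ha' x x' h
      rcases Nat.lt_succ_iff_lt_or_eq.1 ha with h1 | rfl <;>
        rcases Nat.lt_succ_iff_lt_or_eq.1 ha' with h2 | rfl
      · rw [Function.update_of_ne h1.ne, Function.update_of_ne h2.ne] at h
        exact hinj a h1 a' h2 x x' h
      · rw [Function.update_of_ne h1.ne, Function.update_self] at h
        exact (hnot a h1 x x' h).elim
      · rw [Function.update_of_ne h2.ne, Function.update_self] at h
        exact (hnot a' h2 x' x h.symm).elim
      · rw [Function.update_self] at h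
        exact ⟨rfl, hμ h⟩
    · intro a ha B
      rcases Nat.lt_succ_iff_lt_or_eq.1 ha with h1 | rfl
      · rw [Function.update_of_ne h1.ne]
        exact hloc a h1 B
      · rw [Function.update_self]
        exact hμl B

theorem exists_admissible [Fintype F] (hs : 0 < s) (n : ℕ)
    (hF : fieldSizeBound n s ≤ Fintype.card F) : ∃ lam : Scalars F n s, Admissible lam := by
  obtain ⟨lam, hinj, hloc⟩ := exists_scalars_of_groups hs (numGroups n s) hF
  refine ⟨fun abe => lam abe.1 abe.2, ?_, fun a B => ?_⟩
  · rintro ⟨a, x⟩ ⟨a', x'⟩ h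
    obtain ⟨h1, h2⟩ := hinj a a.2 a' a'.2 x x' h
    rw [Fin.ext h1, h2]
  · exact (localMatrix_det_ne_zero_iff _ a B).2 (hloc a a.2 B)

end existence

/-! ### Linear field size and the main theorem -/

theorem fieldSizeBound_le (s : ℕ) {n : ℕ} (hn : 1 ≤ n) :
    fieldSizeBound n s ≤ ((s + 1) * s +
      ∑ t ∈ Finset.Icc 1 (s + 1), (s + 1).choose t * (s * (t * (t - 1) / 2))) * n := by
  have h : numGroups n s ≤ n := by
    rw [numGroups, ceilDiv_le_iff_le_mul (Nat.succ_pos s)]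
    nlinarith
  rw [fieldSizeBound, add_mul ((s + 1) * s)]
  refine add_le_add ?_ (Nat.le_mul_of_pos_right _ hn)
  calc (s + 1) * numGroups n s * s ≤ (s + 1) * n * s := by gcongr
    _ = (s + 1) * s * n := by ring

theorem mainTheorem5 (s : ℕ) (hs : 2 ≤ s) :
    -- the code and its repair schemes, for all admissible scalars
    (∀ (F : Type*) [Field F] (n k d : ℕ), 1 ≤ k → k + 1 ≤ d → d + 1 ≤ n → d + 1 = k + s →
      ∀ lam : Scalars F n s, Admissible lam →
        -- repair of the first `s` nodes of a group, with optimal access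
        (∀ (h : Fin n) (b : Fin s), nodePos s h = b.castSucc →
          (∀ (c : Fin n → SymbolIndex n s → F) (x : RestIndex (nodeGroup s h)) (p : Fin (n - k)),
            (∑ j, (parityCheck lam (n - k) j).mulVec (c j)) (insertDigit (nodeGroup s h) b x, p) =
              (∑ z, (reducedCheckFirst lam (n - k) h b z).mulVec
                (reducedWord h (downloadFirst F (nodeGroup s h) b) c z)) (x, p)) ∧
          Fintype.card (ReducedNode s h) = n + s - 1 ∧
          Fintype.card (RestIndex (nodeGroup s h)) * s = s ^ (n ⌈/⌉ (s + 1)) ∧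
          IsMDSArrayCode (arrayCode (reducedCheckFirst lam (n - k) h b)) (k + s - 1) ∧
          ∀ 𝓗 : Finset (Fin n), h ∉ 𝓗 → 𝓗.card = d →
            Repairs (secondCode lam (n - k)) h 𝓗 (downloadFirst F (nodeGroup s h) b) ∧
            (repairBandwidth 𝓗 (downloadFirst F (nodeGroup s h) b) : ℚ) =
              cutSetBound k d (s ^ (n ⌈/⌉ (s + 1))) ∧
            (repairAccess 𝓗 (downloadFirst F (nodeGroup s h) b) : ℚ) =
              cutSetBound k d (s ^ (n ⌈/⌉ (s + 1)))) ∧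
        -- repair of the last node of a group, by sums of `s` block rows, without optimal access
        (∀ h : Fin n, nodePos s h = Fin.last s →
          (∀ (c : Fin n → SymbolIndex n s → F) (x : RestIndex (nodeGroup s h)) (p : Fin (n - k)),
            ∑ e : Fin s,
              (∑ j, (parityCheck lam (n - k) j).mulVec (c j)) (insertDigit (nodeGroup s h) e x, p) =
              (∑ z, (reducedCheckLast lam (n - k) h z).mulVec
                (reducedWord h (downloadLast F (nodeGroup s h)) c z)) (x, p)) ∧
          Fintype.card (ReducedNode s h) = n + s - 1 ∧
          Fintype.card (RestIndex (nodeGroup s h)) * s = s ^ (n ⌈/⌉ (s + 1)) ∧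
          IsMDSArrayCode (arrayCode (reducedCheckLast lam (n - k) h)) (k + s - 1) ∧
          ∀ 𝓗 : Finset (Fin n), h ∉ 𝓗 → 𝓗.card = d →
            Repairs (secondCode lam (n - k)) h 𝓗 (downloadLast F (nodeGroup s h)) ∧
            (repairBandwidth 𝓗 (downloadLast F (nodeGroup s h)) : ℚ) =
              cutSetBound k d (s ^ (n ⌈/⌉ (s + 1))) ∧
            (∀ j ∈ 𝓗, nodeGroup s j ≠ nodeGroup s h →
              accessedSymbols (downloadLast F (nodeGroup s h) j) = Set.univ) ∧
            ((∃ j ∈ 𝓗, nodeGroup s j ≠ nodeGroup s h) →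
              cutSetBound k d (s ^ (n ⌈/⌉ (s + 1))) <
                (repairAccess 𝓗 (downloadLast F (nodeGroup s h)) : ℚ))) ∧
        IsMSRCode (secondCode lam (n - k)) k d (s ^ (n ⌈/⌉ (s + 1)))) ∧
    -- admissible scalars exist in every finite field that is large enough
    (∀ (F : Type*) [Field F] [Fintype F] (n : ℕ), 1 ≤ n →
      fieldSizeBound n s ≤ Fintype.card F → ∃ lam : Scalars F n s, Admissible lam) ∧
    -- hence a field size linear in `n` suffices
    (∃ K : ℕ, ∀ n k d : ℕ, 1 ≤ k → k + 1 ≤ d → d + 1 ≤ n → d + 1 = k + s →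
      ∃ q : ℕ, IsPrimePow q ∧ q ≤ K * n ∧
        ∀ (F : Type*) [Field F] [Fintype F], Fintype.card F = q →
          ∃ lam : Scalars F n s, Admissible lam ∧
            IsMSRCode (secondCode lam (n - k)) k d (s ^ (n ⌈/⌉ (s + 1)))) := by
  have hs0 : 0 < s := by omega
  refine ⟨?_, fun F _ _ n _ hF => exists_admissible hs0 n hF, ?_⟩
  · intro F _ n k d hk hkd hdn hd lam hlam
    have hkn : k ≤ n := by omega
    refine ⟨fun h b hb => ⟨parityCheck_sum_eq_reducedCheckFirst lam (n - k) h b hb,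
      card_reducedNode h, card_restIndex_mul _, hlam.isMDSArrayCode_reducedCheckFirst hkn h b hb,
      fun 𝓗 hh h𝓗 => ⟨hlam.repairs_downloadFirst hkn hd h b hb 𝓗 hh h𝓗, ?_, ?_⟩⟩,
      fun h hl => ⟨parityCheck_sum_eq_reducedCheckLast lam (n - k) h hl,
      card_reducedNode h, card_restIndex_mul _, hlam.isMDSArrayCode_reducedCheckLast hs0 hkn h hl,
      fun 𝓗 hh h𝓗 => ⟨hlam.repairs_downloadLast hs0 hkn hd h hl 𝓗 hh h𝓗, ?_,
        fun j _ hj => accessedSymbols_downloadLast_of_ne hj, fun hout => ?_⟩⟩,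
      hlam.isMSRCode_secondCode hs0 hkn hd⟩
    · rw [repairBandwidth_restIndex, h𝓗, mul_card_restIndex_eq_cutSetBound hs0 hd]
    · rw [repairAccess_downloadFirst, h𝓗, mul_card_restIndex_eq_cutSetBound hs0 hd]
    · rw [repairBandwidth_restIndex, h𝓗, mul_card_restIndex_eq_cutSetBound hs0 hd]
    · rw [← mul_card_restIndex_eq_cutSetBound hs0 hd (nodeGroup s h), ← h𝓗]
      exact_mod_cast lt_repairAccess_downloadLast hs h hl 𝓗 hh hout
  -- The factor `2` pays for Bertrand's postulate, which supplies a prime between the linear bound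
  -- and its double.
  · refine ⟨2 * ((s + 1) * s +
      ∑ t ∈ Finset.Icc 1 (s + 1), (s + 1).choose t * (s * (t * (t - 1) / 2))),
      fun n k d hk hkd hdn hd => ?_⟩
    have hn : 1 ≤ n := by omega
    obtain ⟨q, hq, hlt, hle⟩ := Nat.exists_prime_lt_and_le_two_mul _
      (Nat.mul_pos (Nat.add_pos_left (Nat.mul_pos s.succ_pos hs0)
        (∑ t ∈ Finset.Icc 1 (s + 1), (s + 1).choose t * (s * (t * (t - 1) / 2)))) hn).ne'
    refine ⟨q, hq.isPrimePow, by rwa [mul_assoc], fun F _ _ hF => ?_⟩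
    obtain ⟨lam, hlam⟩ := exists_admissible (F := F) hs0 n
      (by rw [hF]; exact (fieldSizeBound_le s hn).trans hlt.le)
    exact ⟨lam, hlam, hlam.isMSRCode_secondCode hs0 (by omega) hd⟩
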